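/- Let $\mathbb{F}_q$ be a finite field, $A=\mathbb{F}_q[t]$, $K=\mathbb{F}_q(t)$, $K_\infty=\mathbb{F}_q((1/t))$, let $\mathbb{C}_\infty$ be the completion of an algebraic closure of $K_\infty$, and $\Omega=\mathbb{C}_\infty\setminus K_\infty$. Let $n\ge 1$ and $k\ge 2$ be integers, and put $$\Gamma_1(\mathfrak n)=\{\gamma\in SL_2(A)\mid \gamma\equiv\begin{pmatrix}1&*\\0&1\end{pmatrix}\bmod \mathfrak n\},\qquad (f|_k\gamma)(z)=\det(\gamma)^{k-1}(cz+d)^{-k}f\Big(\frac{az+b}{cz+d}\Big)$$ for $\gamma=\begin{pmatrix}a&b\\c&d\end{pmatrix}\in GL_2(K)$ and $f:\Omega\to\mathbb{C}_\infty$. *Orders at cusps.* Let $\bar\pi\in\mathbb{C}_\infty$ be a Carlitz period: $\bar\pi\neq 0$ and $t\,\bar\pi e_A(z)+(\bar\pi e_A(z))^q=\bar\pi e_A(tz)$ for all $z$, where $e_{\mathfrak b}(z)=z\prod_{0\ne b\in\mathfrak b}(1-z/b)$ for subgroups $\mathfrak b\subseteq A$ containing a nonzero ideal. For a cusp $s\in\mathbb{P}^1(K)$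 choose $\nu_s\in SL_2(A)$ with $\nu_s(\infty)=s$, put $\mathfrak b_s=\{b\in A\mid \nu_s\begin{pmatrix}1&b\\0&1\end{pmatrix}\nu_s^{-1}\in\Gamma_1(t^n)\}$ and $u_s(z)=1/(\bar\pi e_{\mathfrak b_s}(z))$. Let $S_k$ be the $\mathbb{C}_\infty$-vector space of Drinfeld cuspforms of level $\Gamma_1(t^n)$ and weight $k$: the rigid analytic functions $f:\Omega\to\mathbb{C}_\infty$ with $f(\gamma z)=(cz+d)^kf(z)$ for all $\gamma=\begin{pmatrix}a&b\\c&d\end{pmatrix}\in\Gamma_1(t^n)$ such that at every cusp $s$ one has $(f|_k\nu_s)(z)=\sum_{j\ge 1}a_ju_s(z)^j$ whenever $|u_s(z)|$ is sufficiently small. Put $\mathrm{ord}(s,f)=\min\{j\mid a_j\ne 0\}$ (and $\mathrm{ord}(s,0)=\infty$); this does not depend on the choice of $\nu_s$. Let $S_k^{(2)}$ be the subspace of double cuspforms, those $f\in S_k$ with $\mathrm{ord}(s,f)\ge 2$ at all cusps $s$. *The operator $U_t$.* On $S_k$ put $U_tf=\sum_\xi f|_k\xi$, where $\xi$ runs over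 representatives of $\Gamma_1(t^n)\backslash\Gamma_1(t^n)\begin{pmatrix}1&0\\0&t\end{pmatrix}\Gamma_1(t^n)$. *The subspaces.* Write $A_m=A/(t^m)$. For $c\in A_{n-1}$ with a lift $\tilde c\in A$ put $\bar v_t(c)=\min\{v_t(\tilde c),n-1\}$, where $v_t$ is the $t$-adic valuation. For $c,d\in A_{n-1}$ let $h_{(c,d)}\in\Gamma_1(t)$ be a lift of $\begin{pmatrix}\frac{1}{1+td}&0\\tc&1+td\end{pmatrix}\in SL_2(A_n)$. Define $$S'_{k,i}=\{f\in S_k\mid \mathrm{ord}(h_{(c,d)}(\infty),f)\ge 2\text{ for all }(c,d)\in A_{n-1}^2\text{ with }\bar v_t(c)\ge i\}\quad(i\in\mathbb{Z}),$$ $$S'_k=\{f\in S_k\mid \mathrm{ord}(h_{(0,d)}(\infty),f)\ge 2\text{ for all }d\in A_{n-1}\}\supseteq S_k^{(2)}.$$ **Proposition.** For every integer $i\in[0,n-1]$ we have $U_t(S'_{k,i})\subseteq S'_{k,i-1}$. Moreover $U_t(S'_{k,0})\subseteq S_k^{(2)}$. In particular, $U_t$ maps $S'_k$ and $S_k^{(2)}$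 into themselves, and the operator it induces on $S'_k/S_k^{(2)}$ is nilpotent. -/

import Mathlib

open scoped Polynomial NNReal WithZero MatrixGroups

noncomputable section

namespace Drinfeld

/-! ### The fields `K_∞` and `ℂ_∞` -/

section Fields

variable (F : Type*) [Field F]

/-- `K_∞ = 𝔽_q((1/t))`: the completion of `K = 𝔽_q(t)` at the place `∞`. -/
abbrev KInfty : Type _ := @RatFunc.CompletionAtInfty F _ (Classical.decEq _)

lemma valued_KInfty_coe (x : RatFunc F) :
    Valued.v (algebraMap (RatFunc F) (KInfty F) x) =
      @RatFunc.inftyValuation F _ (Classical.decEq _) x := by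
  let _ := Classical.decEq (RatFunc F)
  let _ := RatFunc.inftyValued F
  exact Valued.valuedCompletion_apply (K := RatFunc F) x

variable [Fintype F]

lemma one_lt_card : (1 : ℝ≥0) < (Fintype.card F : ℝ≥0) := by
  exact_mod_cast Fintype.one_lt_card

/-- The absolute value on `K_∞` normalised by `|t| = q`. -/
instance rankOneKInfty : Valuation.RankOne (Valued.v (R := KInfty F) (Γ₀ := ℤᵐ⁰)) where
  hom' := (WithZeroMulInt.toNNReal (one_lt_card F).ne_bot).comp
    MonoidWithZeroHom.ValueGroup₀.embedding
  strictMono' := (WithZeroMulInt.toNNReal_strictMono (one_lt_card F)).comp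
    MonoidWithZeroHom.ValueGroup₀.embedding_strictMono
  exists_val_nontrivial := by
    refine ⟨algebraMap (RatFunc F) (KInfty F) RatFunc.X, ?_⟩
    rw [valued_KInfty_coe, RatFunc.inftyValuation.X]
    exact ⟨by simp, by decide⟩

instance : NontriviallyNormedField (KInfty F) :=
  Valued.toNontriviallyNormedField (KInfty F) ℤᵐ⁰

instance : IsUltrametricDist (KInfty F) :=
  Valued.instIsUltrametricDist (KInfty F) ℤᵐ⁰

instance : CompleteSpace (KInfty F) :=
  let _ := Classical.decEq (RatFunc F)
  @UniformSpace.Completion.completeSpace (RatFunc F) (RatFunc.inftyValued F).toUniformSpace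

/-- The algebraic closure of `K_∞`. -/
abbrev KInftyAlgCl : Type _ := AlgebraicClosure (KInfty F)

/-- The unique extension to the algebraic closure of the absolute value of `K_∞`. -/
instance : NontriviallyNormedField (KInftyAlgCl F) :=
  spectralNorm.nontriviallyNormedField (KInfty F) (KInftyAlgCl F)

/-- `ℂ_∞`: the completion of the algebraic closure of `K_∞`. -/
abbrev CInfty : Type _ := UniformSpace.Completion (KInftyAlgCl F)


variable {F}

/-- The embedding `K_∞ → ℂ_∞`. -/
def ofKInfty : KInfty F →+* CInfty F :=
  UniformSpace.Completion.coeRingHom.comp (algebraMap (KInfty F) (KInftyAlgCl F))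

/-- The embedding `K → ℂ_∞`. -/
def ofK : RatFunc F →+* CInfty F := ofKInfty.comp (algebraMap (RatFunc F) (KInfty F))

/-- The embedding `A → ℂ_∞`. -/
def ofA : F[X] →+* CInfty F := ofK.comp (algebraMap F[X] (RatFunc F))

end Fields

variable {F : Type*} [Field F] [Fintype F]

/-! ### The Drinfeld upper half plane and rigid analytic functions -/

variable (F) in
/-- The Drinfeld upper half plane `Ω = ℂ_∞ ∖ K_∞`. -/
def Omega : Type _ := {z : CInfty F // z ∉ Set.range (ofKInfty (F := F))}

instance : Coe (Omega F) (CInfty F) := ⟨Subtype.val⟩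

lemma den_ne_zero (γ : GL (Fin 2) (RatFunc F)) (z : Omega F) :
    ofK (γ 1 0) * (z : CInfty F) + ofK (γ 1 1) ≠ 0 := by
  intro h
  have hdet : γ 0 0 * γ 1 1 - γ 0 1 * γ 1 0 ≠ 0 := by
    have := γ.det.ne_zero
    rwa [Matrix.GeneralLinearGroup.val_det_apply, Matrix.det_fin_two] at this
  by_cases hc : γ 1 0 = 0
  · have hd : γ 1 1 = 0 := by simpa [hc] using h
    simp [hc, hd] at hdet
  · refine z.2 ⟨algebraMap _ _ (-(γ 1 1) / γ 1 0), ?_⟩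
    have hc' : ofK (γ 1 0) ≠ 0 := by simpa using hc
    change ofK (-(γ 1 1) / γ 1 0) = _
    rw [map_div₀, map_neg, div_eq_iff hc']
    linear_combination -h

/-- The action of `GL₂(K)` on `Ω` by `z ↦ (az + b) / (cz + d)`. -/
def moebius (γ : GL (Fin 2) (RatFunc F)) (z : Omega F) : Omega F :=
  ⟨(ofK (γ 0 0) * (z : CInfty F) + ofK (γ 0 1)) / (ofK (γ 1 0) * (z : CInfty F) + ofK (γ 1 1)), by
    rintro ⟨w, hw⟩
    have hz := den_ne_zero γ z
    have hdet : ofK (γ 0 0) * ofK (γ 1 1) - ofK (γ 0 1) * ofK (γ 1 0) ≠ 0 := by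
      have := γ.det.ne_zero
      rw [Matrix.GeneralLinearGroup.val_det_apply, Matrix.det_fin_two] at this
      rwa [← map_mul, ← map_mul, ← map_sub, Ne, map_eq_zero]
    rw [eq_div_iff hz] at hw
    set a := algebraMap (RatFunc F) (KInfty F) (γ 0 0)
    set b := algebraMap (RatFunc F) (KInfty F) (γ 0 1)
    set c := algebraMap (RatFunc F) (KInfty F) (γ 1 0)
    set d := algebraMap (RatFunc F) (KInfty F) (γ 1 1)
    change ofKInfty w * (ofKInfty c * z + ofKInfty d) = ofKInfty a * z + ofKInfty b at hw
    change ofKInfty a * ofKInfty d - ofKInfty b * ofKInfty c ≠ 0 at hdet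
    have key : (ofKInfty a - ofKInfty w * ofKInfty c) * (z : CInfty F) =
        ofKInfty w * ofKInfty d - ofKInfty b := by linear_combination -hw
    by_cases h0 : ofKInfty a - ofKInfty w * ofKInfty c = 0
    · have h1 : ofKInfty w * ofKInfty d - ofKInfty b = 0 := by rw [← key, h0, zero_mul]
      exact hdet (by linear_combination ofKInfty d * h0 + ofKInfty c * h1)
    · refine z.2 ⟨(w * d - b) / (a - w * c), ?_⟩
      rw [map_div₀, map_sub, map_sub, map_mul, map_mul, div_eq_iff h0, ← key, mul_comm]⟩

variable (F) in
/-- The affinoid `{z | |z| ≤ q^m, |z - x| ≥ q^{-m} for all x ∈ K_∞}`. For `m = 0, 1, 2, …` these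
form the standard admissible covering of `Ω`. -/
def affinoid (m : ℕ) : Set (CInfty F) :=
  {z | ‖z‖ ≤ (Fintype.card F : ℝ) ^ m ∧
    ∀ x : KInfty F, ((Fintype.card F : ℝ) ^ m)⁻¹ ≤ ‖z - ofKInfty x‖}

/-- `f : Ω → ℂ_∞` is rigid analytic: on each affinoid of the standard covering it is a
uniform limit of rational functions without poles there. -/
def IsRigidAnalytic (f : Omega F → CInfty F) : Prop :=
  ∀ m : ℕ, ∀ ε : ℝ, 0 < ε → ∃ P Q : (CInfty F)[X],
    (∀ z ∈ affinoid F m, Q.eval z ≠ 0) ∧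
    ∀ z : Omega F, (z : CInfty F) ∈ affinoid F m →
      ‖f z - P.eval (z : CInfty F) / Q.eval (z : CInfty F)‖ ≤ ε

/-! ### The slash operator, the groups `Γ₁(𝔫)`, Hecke operators -/

/-- The slash operator
`(f|_k γ)(z) = det(γ)^{k-1} (cz + d)^{-k} f((az + b)/(cz + d))`, as a linear map in `f`. -/
def slash (k : ℤ) (γ : GL (Fin 2) (RatFunc F)) : Module.End (CInfty F) (Omega F → CInfty F) where
  toFun f z := ofK (γ 0 0 * γ 1 1 - γ 0 1 * γ 1 0) ^ (k - 1) *
    (ofK (γ 1 0) * (z : CInfty F) + ofK (γ 1 1)) ^ (-k) * f (moebius γ z)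
  map_add' f g := by ext z; simp [mul_add]
  map_smul' c f := by ext z; simp; ring

/-- The inclusion `SL₂(A) → GL₂(K)`. -/
def slToGL : SL(2, F[X]) →* GL (Fin 2) (RatFunc F) :=
  Matrix.SpecialLinearGroup.toGL.comp
    (Matrix.SpecialLinearGroup.map (algebraMap F[X] (RatFunc F)))

/-- `Γ₁(𝔫)`: the matrices in `SL₂(A)` congruent to `(1 *; 0 1)` modulo `𝔫`. -/
def Gamma1 (𝔫 : F[X]) : Subgroup SL(2, F[X]) where
  carrier := {γ | 𝔫 ∣ γ 0 0 - 1 ∧ 𝔫 ∣ γ 1 0 ∧ 𝔫 ∣ γ 1 1 - 1}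
  one_mem' := by simp
  mul_mem' := by
    rintro γ δ ⟨⟨a, ha⟩, ⟨b, hb⟩, ⟨c, hc⟩⟩ ⟨⟨a', ha'⟩, ⟨b', hb'⟩, ⟨c', hc'⟩⟩
    simp only [Set.mem_ofPred_eq, Matrix.SpecialLinearGroup.coe_mul, Matrix.mul_apply,
      Fin.sum_univ_two]
    refine ⟨⟨a + γ 0 0 * a' + γ 0 1 * b', ?_⟩, ⟨b * δ 0 0 + γ 1 1 * b', ?_⟩,
      ⟨b * δ 0 1 + c + γ 1 1 * c', ?_⟩⟩
    · linear_combination ha + γ 0 0 * ha' + γ 0 1 * hb'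
    · linear_combination δ 0 0 * hb + γ 1 1 * hb'
    · linear_combination δ 0 1 * hb + hc + γ 1 1 * hc'
  inv_mem' := by
    rintro γ ⟨ha, hb, hc⟩
    rw [Set.mem_ofPred_eq, Matrix.SpecialLinearGroup.SL2_inv_expl]
    exact ⟨hc, by simpa using hb, ha⟩

/-- The diagonal matrix `(1 0; 0 𝔪)` in `GL₂(K)`, for a nonzero `𝔪 ∈ A`. -/
def diagGL (𝔪 : F[X]) (h𝔪 : 𝔪 ≠ 0) : GL (Fin 2) (RatFunc F) :=
  Matrix.GeneralLinearGroup.mkOfDetNeZero !![1, 0; 0, algebraMap F[X] (RatFunc F) 𝔪]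
    (by simpa [Matrix.det_fin_two] using h𝔪)

/-- The Hecke operator `T_𝔪 f = ∑_ξ f|_k ξ` of level `Γ₁(𝔫)`, where `ξ` runs over
representatives of `Γ₁(𝔫) \ Γ₁(𝔫) (1 0; 0 𝔪) Γ₁(𝔫)`. (This coset space is finite, and
on functions invariant under `Γ₁(𝔫)` the choice of representatives is irrelevant.) -/
def hecke (𝔫 : F[X]) (k : ℤ) (𝔪 : F[X]) (h𝔪 : 𝔪 ≠ 0) :
    Module.End (CInfty F) (Omega F → CInfty F) :=
  let Γ : Subgroup (GL (Fin 2) (RatFunc F)) := (Gamma1 𝔫).map slToGL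
  ∑ᶠ ξ ∈ (Quotient.mk (QuotientGroup.rightRel Γ)) '' (DoubleCoset.doubleCoset (diagGL 𝔪 h𝔪) Γ Γ),
    slash k ξ.out

/-- The operator `U_t` of level `Γ₁(t^n)` and weight `k`. -/
def Ut (n : ℕ) (k : ℤ) : Module.End (CInfty F) (Omega F → CInfty F) :=
  hecke (Polynomial.X ^ n) k Polynomial.X Polynomial.X_ne_zero

/-! ### Uniformizers and Fourier expansions at the cusps -/

/-- `e_𝔟(z) = z ∏_{0 ≠ b ∈ 𝔟} (1 - z / b)`. -/
def expo (𝔟 : AddSubgroup F[X]) (z : CInfty F) : CInfty F :=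
  z * ∏' b : {b : F[X] // b ∈ 𝔟 ∧ b ≠ 0}, (1 - z / ofA (b : F[X]))

/-- `π` is a Carlitz period: it is nonzero, and `π A` is the period lattice of the Carlitz module
`Φ_t(Z) = tZ + Z^q`, that is, `Φ_t(π e_A(z)) = π e_A(tz)`. -/
def IsCarlitzPeriod (π : CInfty F) : Prop :=
  π ≠ 0 ∧ ∀ z : CInfty F,
    ofA Polynomial.X * (π * expo ⊤ z) + (π * expo ⊤ z) ^ Fintype.card F =
      π * expo ⊤ (ofA Polynomial.X * z)

/-- `u_𝔟(z) = 1 / (π e_𝔟(z))`. -/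
def unif (π : CInfty F) (𝔟 : AddSubgroup F[X]) (z : CInfty F) : CInfty F :=
  1 / (π * expo 𝔟 z)

/-- The translation matrix `(1 b; 0 1)`. -/
def transl (b : F[X]) : SL(2, F[X]) := ⟨!![1, b; 0, 1], by simp [Matrix.det_fin_two]⟩

lemma transl_add (b c : F[X]) : transl (b + c) = transl b * transl c := by
  apply Subtype.ext
  change !![1, b + c; 0, 1] = !![1, b; 0, 1] * !![1, c; 0, 1]
  simp [add_comm]

lemma transl_zero : transl (0 : F[X]) = 1 := by
  apply Subtype.ext
  simp [transl, Matrix.one_fin_two]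

lemma transl_neg (b : F[X]) : transl (-b) = (transl b)⁻¹ := by
  rw [eq_inv_iff_mul_eq_one, ← transl_add, neg_add_cancel, transl_zero]

/-- The group `{b ∈ A | (1 b; 0 1) ∈ ν⁻¹ Γ₁(𝔫) ν}` attached to `ν ∈ SL₂(A)`. -/
def width (𝔫 : F[X]) (ν : SL(2, F[X])) : AddSubgroup F[X] where
  carrier := {b | ν * transl b * ν⁻¹ ∈ Gamma1 𝔫}
  zero_mem' := by simp [transl_zero, one_mem]
  add_mem' {b c} hb hc := by
    have : ν * transl (b + c) * ν⁻¹ = (ν * transl b * ν⁻¹) * (ν * transl c * ν⁻¹) := by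
      rw [transl_add]; group
    rw [Set.mem_ofPred_eq, this]
    exact mul_mem hb hc
  neg_mem' {b} hb := by
    have : ν * transl (-b) * ν⁻¹ = (ν * transl b * ν⁻¹)⁻¹ := by rw [transl_neg]; group
    rw [Set.mem_ofPred_eq, this]
    exact inv_mem hb

/-- `(f|_k ν)(z) = ∑_{i ≥ 0} a_i u_s(z)^i` whenever `|u_s(z)|` is sufficiently small, where
`u_s` is the uniformizer at the cusp `s = ν(∞)` for `Γ₁(𝔫)`. -/
def IsFourierExpansion (π : CInfty F) (𝔫 : F[X]) (k : ℤ) (ν : SL(2, F[X]))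
    (f : Omega F → CInfty F) (a : PowerSeries (CInfty F)) : Prop :=
  ∃ ε : ℝ, 0 < ε ∧ ∀ z : Omega F, ‖unif π (width 𝔫 ν) (z : CInfty F)‖ < ε →
    HasSum (fun i : ℕ ↦ PowerSeries.coeff i a * unif π (width 𝔫 ν) (z : CInfty F) ^ i)
      (slash k (slToGL ν) f z)

/-- The order of vanishing of `f|_k ν` in the uniformizer at `ν(∞)`: the order (possibly `∞`) of
its Fourier expansion, and `0` if there is no Fourier expansion. -/
def ordAt (π : CInfty F) (𝔫 : F[X]) (k : ℤ) (ν : SL(2, F[X]))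
    (f : Omega F → CInfty F) : ℕ∞ :=
  sSup {m | ∃ a, IsFourierExpansion π 𝔫 k ν f a ∧ m = a.order}

/-- The cusp `ν(∞) ∈ ℙ¹(K)`. -/
def cusp (ν : SL(2, F[X])) : OnePoint (RatFunc F) :=
  letI := Classical.decEq (RatFunc F)
  slToGL ν • (OnePoint.infty : OnePoint (RatFunc F))

/-- `ord(s, f)` for a cusp `s ∈ ℙ¹(K)`. For modular forms `f` of level `Γ₁(𝔫)` the order along `ν`
is the same for all `ν ∈ SL₂(A)` with `ν(∞) = s`. -/
def cuspOrd (π : CInfty F) (𝔫 : F[X]) (k : ℤ) (s : OnePoint (RatFunc F))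
    (f : Omega F → CInfty F) : ℕ∞ :=
  ⨅ (ν : SL(2, F[X])) (_ : cusp ν = s), ordAt π 𝔫 k ν f

lemma natCast_le_ordAt {π : CInfty F} {𝔫 : F[X]} {k : ℤ} {ν : SL(2, F[X])}
    {f : Omega F → CInfty F} {m : ℕ} (hm : m ≠ 0) :
    (m : ℕ∞) ≤ ordAt π 𝔫 k ν f ↔ ∃ a, IsFourierExpansion π 𝔫 k ν f a ∧ (m : ℕ∞) ≤ a.order := by
  constructor
  · intro h
    by_contra! hcon
    have : ordAt π 𝔫 k ν f ≤ ((m - 1 : ℕ) : ℕ∞) := by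
      refine sSup_le ?_
      rintro _ ⟨a, ha, rfl⟩
      have hlt := hcon a ha
      obtain ⟨j, hj⟩ := ENat.ne_top_iff_exists.1 hlt.ne_top
      rw [← hj] at hlt ⊢
      have : j < m := by exact_mod_cast hlt
      exact_mod_cast (by omega : j ≤ m - 1)
    have h2 : m ≤ m - 1 := by exact_mod_cast h.trans this
    omega
  · rintro ⟨a, ha, hle⟩
    exact hle.trans (le_sSup ⟨a, ha, rfl⟩)

lemma natCast_le_cuspOrd {π : CInfty F} {𝔫 : F[X]} {k : ℤ} {s : OnePoint (RatFunc F)}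
    {f : Omega F → CInfty F} {m : ℕ} (hm : m ≠ 0) :
    (m : ℕ∞) ≤ cuspOrd π 𝔫 k s f ↔ ∀ ν, cusp ν = s →
      ∃ a, IsFourierExpansion π 𝔫 k ν f a ∧ (m : ℕ∞) ≤ a.order := by
  simp only [cuspOrd, le_iInf_iff, natCast_le_ordAt hm]

/-- The functions with `ord(s, f) ≥ m` form a subspace, for `m ≥ 1`. -/
def vanishing (π : CInfty F) (𝔫 : F[X]) (k : ℤ) (s : OnePoint (RatFunc F)) (m : ℕ) (hm : m ≠ 0) :
    Submodule (CInfty F) (Omega F → CInfty F) where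
  carrier := {f | (m : ℕ∞) ≤ cuspOrd π 𝔫 k s f}
  zero_mem' := by
    rw [Set.mem_ofPred_eq, natCast_le_cuspOrd hm]
    refine fun ν _ ↦ ⟨0, ⟨1, one_pos, fun z _ ↦ ?_⟩, by simp⟩
    simp
  add_mem' {f g} hf hg := by
    rw [Set.mem_ofPred_eq, natCast_le_cuspOrd hm] at *
    intro ν hν
    obtain ⟨a, ⟨ε, hε, ha⟩, ham⟩ := hf ν hν
    obtain ⟨b, ⟨δ, hδ, hb⟩, hbm⟩ := hg ν hν
    refine ⟨a + b, ⟨min ε δ, lt_min hε hδ, fun z hz ↦ ?_⟩,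
      (le_min ham hbm).trans (PowerSeries.min_order_le_order_add a b)⟩
    simpa [add_mul] using
      (ha z (hz.trans_le (min_le_left _ _))).add (hb z (hz.trans_le (min_le_right _ _)))
  smul_mem' c f hf := by
    rw [Set.mem_ofPred_eq, natCast_le_cuspOrd hm] at *
    intro ν hν
    obtain ⟨a, ⟨ε, hε, ha⟩, ham⟩ := hf ν hν
    refine ⟨c • a, ⟨ε, hε, fun z hz ↦ ?_⟩, ham.trans PowerSeries.le_order_smul⟩
    simpa [mul_assoc] using (ha z hz).mul_left c

/-! ### Drinfeld cuspforms -/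

/-- `S_k(Γ₁(𝔫))`: rigid analytic functions on `Ω` which are invariant under the weight `k` action
of `Γ₁(𝔫)` and at every cusp have a Fourier expansion without constant term. -/
def cuspForms (π : CInfty F) (𝔫 : F[X]) (k : ℤ) : Submodule (CInfty F) (Omega F → CInfty F) where
  carrier := {f | IsRigidAnalytic f ∧
    (∀ γ ∈ Gamma1 𝔫, ∀ z : Omega F, f (moebius (slToGL γ) z) =
      (ofA (γ 1 0) * (z : CInfty F) + ofA (γ 1 1)) ^ k * f z) ∧
    ∀ s, 1 ≤ cuspOrd π 𝔫 k s f}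
  zero_mem' := by
    refine ⟨fun m ε hε ↦ ⟨0, 1, by simp, fun z _ ↦ by simpa using hε.le⟩, by simp, fun s ↦ ?_⟩
    exact_mod_cast (vanishing π 𝔫 k s 1 one_ne_zero).zero_mem
  add_mem' {f g} hf hg := by
    refine ⟨fun m ε hε ↦ ?_, fun γ hγ z ↦ ?_, fun s ↦ ?_⟩
    · obtain ⟨P, Q, hQ, hP⟩ := hf.1 m (ε / 2) (by positivity)
      obtain ⟨P', Q', hQ', hP'⟩ := hg.1 m (ε / 2) (by positivity)
      refine ⟨P * Q' + P' * Q, Q * Q', fun z hz ↦ by simpa using ⟨hQ z hz, hQ' z hz⟩,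
        fun z hz ↦ ?_⟩
      have h1 := hQ z hz
      have h2 := hQ' z hz
      have : (f + g) z - (P * Q' + P' * Q).eval (z : CInfty F) / (Q * Q').eval (z : CInfty F) =
          (f z - P.eval (z : CInfty F) / Q.eval (z : CInfty F)) +
          (g z - P'.eval (z : CInfty F) / Q'.eval (z : CInfty F)) := by
        simp only [Pi.add_apply, Polynomial.eval_add, Polynomial.eval_mul]
        field_simp
        ring
      rw [this]
      calc _ ≤ _ := norm_add_le _ _
        _ ≤ ε / 2 + ε / 2 := add_le_add (hP z hz) (hP' z hz)
        _ = ε := by ring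
    · simp only [Pi.add_apply, hf.2.1 γ hγ z, hg.2.1 γ hγ z, mul_add]
    · have h1 : f ∈ vanishing π 𝔫 k s 1 one_ne_zero := by exact_mod_cast hf.2.2 s
      have h2 : g ∈ vanishing π 𝔫 k s 1 one_ne_zero := by exact_mod_cast hg.2.2 s
      exact_mod_cast (vanishing π 𝔫 k s 1 one_ne_zero).add_mem h1 h2
  smul_mem' c f hf := by
    refine ⟨fun m ε hε ↦ ?_, fun γ hγ z ↦ ?_, fun s ↦ ?_⟩
    · obtain ⟨P, Q, hQ, hP⟩ := hf.1 m (ε / (‖c‖ + 1)) (by positivity)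
      refine ⟨Polynomial.C c * P, Q, hQ, fun z hz ↦ ?_⟩
      have : (c • f) z - (Polynomial.C c * P).eval (z : CInfty F) / Q.eval (z : CInfty F) =
          c * (f z - P.eval (z : CInfty F) / Q.eval (z : CInfty F)) := by
        simp only [Pi.smul_apply, smul_eq_mul, Polynomial.eval_mul, Polynomial.eval_C]
        ring
      rw [this, norm_mul]
      have h1 := hP z hz
      rw [le_div_iff₀ (by positivity)] at h1
      nlinarith [norm_nonneg (f z - P.eval (z : CInfty F) / Q.eval (z : CInfty F))]
    · simp only [Pi.smul_apply, smul_eq_mul, hf.2.1 γ hγ z]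
      ring
    · have h1 : f ∈ vanishing π 𝔫 k s 1 one_ne_zero := by exact_mod_cast hf.2.2 s
      exact_mod_cast (vanishing π 𝔫 k s 1 one_ne_zero).smul_mem c h1

/-- `S_k^{(2)}(Γ₁(𝔫))`: the cuspforms which vanish to order at least two at all cusps. -/
def doubleCuspForms (π : CInfty F) (𝔫 : F[X]) (k : ℤ) : Submodule (CInfty F) (Omega F → CInfty F) where
  carrier := {f | f ∈ cuspForms π 𝔫 k ∧ ∀ s, 2 ≤ cuspOrd π 𝔫 k s f}
  zero_mem' := ⟨zero_mem _, fun s ↦ (vanishing π 𝔫 k s 2 two_ne_zero).zero_mem⟩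
  add_mem' hf hg := ⟨add_mem hf.1 hg.1,
    fun s ↦ (vanishing π 𝔫 k s 2 two_ne_zero).add_mem (hf.2 s) (hg.2 s)⟩
  smul_mem' c _ hf := ⟨Submodule.smul_mem _ c hf.1,
    fun s ↦ (vanishing π 𝔫 k s 2 two_ne_zero).smul_mem c (hf.2 s)⟩

/-! ### Level `Γ₁(t^n)` -/

variable (F) in
/-- `A_n = A / (t^n)`. -/
abbrev An (n : ℕ) : Type _ := F[X] ⧸ Ideal.span {(Polynomial.X : F[X]) ^ n}

/-- `v̄_t(c) = min {v_t(c̃), n - 1}` for `c ∈ A_{n-1}`, where `c̃ ∈ A` is any lift of `c`. -/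
def vbar (n : ℕ) (c : An F (n - 1)) : ℕ :=
  (min (emultiplicity (Polynomial.X : F[X]) c.out) ((n - 1 : ℕ) : ℕ∞)).toNat

/-- The matrix `h̄_{(c,d)} = (1/(1 + td)  0; tc  1 + td)` over `A_n`, for `c, d ∈ A_{n-1}`; here
`tc` is the class of `t c̃` for any lift `c̃ ∈ A` of `c`, and likewise for `td`. -/
def hbar (n : ℕ) (c d : An F (n - 1)) : Matrix (Fin 2) (Fin 2) (An F n) :=
  let tc : An F n := Ideal.Quotient.mk _ (Polynomial.X * c.out)
  let td : An F n := Ideal.Quotient.mk _ (Polynomial.X * d.out)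
  !![Ring.inverse (1 + td), 0; tc, 1 + td]

/-- `h ∈ Γ₁(t)` is a lift of `h̄_{(c,d)}`. -/
def IsLift (n : ℕ) (c d : An F (n - 1)) (h : SL(2, F[X])) : Prop :=
  h ∈ Gamma1 (Polynomial.X : F[X]) ∧
    (h : Matrix (Fin 2) (Fin 2) F[X]).map (Ideal.Quotient.mk _) = hbar n c d

variable (F) in
/-- `C_i = {(c,d) ∈ A_{n-1}² | v̄_t(c) ≥ i}`. -/
def cuspIndex (n : ℕ) (i : ℤ) : Set (An F (n - 1) × An F (n - 1)) := {p | i ≤ vbar n p.1}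

/-- `S'_{k,i}`: the cuspforms of level `Γ₁(t^n)` and weight `k` with `ord(h_{(c,d)}(∞), f) ≥ 2` for
all `(c,d) ∈ C_i`. (The function `f|_k h_{(c,d)}` does not depend on the lift `h_{(c,d)}`.) -/
def SprimeI (π : CInfty F) (n : ℕ) (k i : ℤ) : Submodule (CInfty F) (Omega F → CInfty F) where
  carrier := {f | f ∈ cuspForms π (Polynomial.X ^ n) k ∧ ∀ p ∈ cuspIndex F n i, ∀ h, IsLift n p.1 p.2 h →
    2 ≤ cuspOrd π (Polynomial.X ^ n) k (cusp h) f}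
  zero_mem' := ⟨zero_mem _, fun _ _ _ _ ↦ (vanishing π _ k _ 2 two_ne_zero).zero_mem⟩
  add_mem' hf hg := ⟨add_mem hf.1 hg.1, fun p hp h hh ↦
    (vanishing π _ k _ 2 two_ne_zero).add_mem (hf.2 p hp h hh) (hg.2 p hp h hh)⟩
  smul_mem' c _ hf := ⟨Submodule.smul_mem _ c hf.1, fun p hp h hh ↦
    (vanishing π _ k _ 2 two_ne_zero).smul_mem c (hf.2 p hp h hh)⟩

/-- `S'_k`: the cuspforms of level `Γ₁(t^n)` and weight `k` with `ord(h_{(0,d)}(∞), f) ≥ 2` for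
all `d ∈ A_{n-1}`. -/
def Sprime (π : CInfty F) (n : ℕ) (k : ℤ) : Submodule (CInfty F) (Omega F → CInfty F) where
  carrier := {f | f ∈ cuspForms π (Polynomial.X ^ n) k ∧ ∀ d, ∀ h, IsLift n 0 d h →
    2 ≤ cuspOrd π (Polynomial.X ^ n) k (cusp h) f}
  zero_mem' := ⟨zero_mem _, fun _ _ _ ↦ (vanishing π _ k _ 2 two_ne_zero).zero_mem⟩
  add_mem' hf hg := ⟨add_mem hf.1 hg.1, fun d h hh ↦
    (vanishing π _ k _ 2 two_ne_zero).add_mem (hf.2 d h hh) (hg.2 d h hh)⟩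
  smul_mem' c _ hf := ⟨Submodule.smul_mem _ c hf.1, fun d h hh ↦
    (vanishing π _ k _ 2 two_ne_zero).smul_mem c (hf.2 d h hh)⟩

lemma doubleCuspForms_le_Sprime (π : CInfty F) (n : ℕ) (k : ℤ) : doubleCuspForms π (Polynomial.X ^ n) k ≤ Sprime π n k :=
  fun _ hf ↦ ⟨hf.1, fun _ _ _ ↦ hf.2 _⟩

/-- `S_k^{(2)}` as a subspace of `S'_k`. -/
abbrev doubleInUnramified (π : CInfty F) (n : ℕ) (k : ℤ) : Submodule (CInfty F) (Sprime π n k) :=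
  (doubleCuspForms π (Polynomial.X ^ n) k).submoduleOf (Sprime π n k)

end Drinfeld

end

noncomputable section

/-! ### Infinite products over an ultrametric field, and additive polynomials. -/

section Ultrametric

variable {K ι : Type*} [NormedField K] [IsUltrametricDist K]
open Filter Topology

/-! On invariant functions `U_t` is the finite sum of the slash operators of `(1 β; 0 t)`, `β ∈ 𝔽_q`
(`Ut_apply`). Its effect at a cusp `ν(∞)` depends only on `v`, the `t`-adic valuation of the lower
left entry of `ν` capped at `n`; the uniformizer there belongs to the lattice `(t^(n-v))`
(`width_eq`).

If `v < n`, push `(1 β; 0 t)` to the right past `ν`. Usually this gives `μ (1 b; 0 t)` with `μ` of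
valuation `v + 1`. Pulling back along `z ↦ (z + b)/t` replaces the uniformizer by a unit multiple of
the uniformizer at `ν`, so orders are kept. The exception, possible only for `v = 0`, is `μ (t 0; 0
1)` with `μ` again of valuation `0`; there the Carlitz equation turns `u` into `u^q` times a unit,
and order at least `1` becomes order at least `q ≥ 2`. This is `hasExpansion_slash_shiftGL_mul`.

If `v = n`, the lattice is `A` and `ν` commutes with the sum over `β`. The values `1/u((z + β)/t)`
are the roots of `Y^q + tY = 1/u(z)`, so by Newton's identities the sum of the `u((z + β)/t)^m` is a
polynomial in `u(z)`, without constant term, and divisible by `u²` once `m ≥ 2`. Hence order at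
least `2` is preserved (`HasSeries.shiftSum`).

Together (`vanishesAt_shiftSum`): if a cuspform `f` has order at least `2` at the cusps with `v ≥ i
+ 1`, where `i < n`, then `U_t f` has order at least `2` at those with `v ≥ i`. The cusps with `v ≥
1` are exactly the `h_{(c,d)}(∞)`, with `v = v̄_t(c) + 1`, so each application of `U_t` lowers the
index of `S'_{k,i}` by one, and after `n` applications to `S'_k = S'_{k,n-1}` every cusp is reached.
-/

theorem IsUltrametricDist.norm_prod_one_add_sub_one_le (s : Finset ι) (f : ι → K) {r : ℝ}
    (hr : 0 ≤ r) (hr1 : r ≤ 1) (h : ∀ i ∈ s, ‖f i‖ ≤ r) : ‖∏ i ∈ s, (1 + f i) - 1‖ ≤ r := by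
  classical
  induction s using Finset.induction_on with
  | empty => simpa
  | insert i s hi ih =>
    rw [Finset.prod_insert hi]
    have h1 := ih fun j hj ↦ h j (Finset.mem_insert_of_mem hj)
    have h2 := h i (Finset.mem_insert_self i s)
    have h3 : (1 + f i) * ∏ j ∈ s, (1 + f j) - 1 =
      (∏ j ∈ s, (1 + f j) - 1) + (f i + f i * (∏ j ∈ s, (1 + f j) - 1)) := by ring
    rw [h3]
    refine (norm_add_le_max _ _).trans (max_le h1 ((norm_add_le_max _ _).trans (max_le h2 ?_)))
    rw [norm_mul]
    nlinarith [norm_nonneg (f i)]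

theorem IsUltrametricDist.norm_one_add_eq_one {x : K} (hx : ‖x‖ < 1) : ‖1 + x‖ = 1 := by
  have := IsUltrametricDist.norm_add_eq_max_of_norm_ne_norm (x := (1 : K)) (y := x)
    (by rw [norm_one]; exact hx.ne')
  rw [this, norm_one, max_eq_left hx.le]

theorem IsUltrametricDist.norm_prod_one_add_eq {f : ι → K} {s t : Finset ι} (hst : s ⊆ t)
    (h : ∀ i ∉ s, ‖f i‖ < 1) : ‖∏ i ∈ t, (1 + f i)‖ = ‖∏ i ∈ s, (1 + f i)‖ := by
  classical
  rw [← Finset.prod_sdiff hst, norm_mul, norm_prod, Finset.prod_eq_one, one_mul]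
  intro i hi
  exact norm_one_add_eq_one (h i (Finset.mem_sdiff.1 hi).2)

/-- Partial products containing the finitely many factors with `‖f i‖ ≥ 1` all have the same norm,
and enlarging one multiplies it by something close to `1`; so they form a Cauchy net. -/
theorem IsUltrametricDist.multipliable_one_add [CompleteSpace K] {f : ι → K}
    (hf : Tendsto f cofinite (𝓝 0)) : Multipliable fun i ↦ 1 + f i := by
  classical
  have hfin (ε : ℝ) (hε : 0 < ε) : {i | ε ≤ ‖f i‖}.Finite := by
    have := (Metric.tendsto_nhds.1 hf ε hε)
    simpa [Filter.eventually_cofinite] using this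
  set s₀ := (hfin 1 one_pos).toFinset with hs₀
  have hs : ∀ i ∉ s₀, ‖f i‖ < 1 := fun i hi ↦ by simpa [hs₀] using hi
  set M := ‖∏ i ∈ s₀, (1 + f i)‖
  have hcau : CauchySeq fun s : Finset ι ↦ ∏ i ∈ s, (1 + f i) := by
    refine Metric.cauchySeq_iff'.2 fun ε hε ↦ ?_
    have hM : 0 < M + 1 := by positivity
    set δ := min (ε / (M + 1)) 1
    have hδ : 0 < δ := lt_min (by positivity) one_pos
    refine ⟨s₀ ∪ (hfin δ hδ).toFinset, fun t ht ↦ ?_⟩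
    set s := s₀ ∪ (hfin δ hδ).toFinset
    have hst : s ⊆ t := ht
    have hMs : ‖∏ i ∈ s, (1 + f i)‖ = M := norm_prod_one_add_eq Finset.subset_union_left hs
    have : ∏ i ∈ t, (1 + f i) - ∏ i ∈ s, (1 + f i) =
        (∏ i ∈ s, (1 + f i)) * (∏ i ∈ t \ s, (1 + f i) - 1) := by
      rw [mul_sub, mul_one, mul_comm, Finset.prod_sdiff hst]
    rw [dist_eq_norm, this, norm_mul, hMs]
    have h1 : ‖∏ i ∈ t \ s, (1 + f i) - 1‖ ≤ δ := by
      refine norm_prod_one_add_sub_one_le _ _ hδ.le (min_le_right _ _) fun i hi ↦ ?_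
      have := (Finset.mem_sdiff.1 hi).2
      simp only [s, Finset.mem_union, not_or, Set.Finite.mem_toFinset, Set.mem_ofPred_eq] at this
      exact (not_le.1 this.2).le
    calc M * _ ≤ M * (ε / (M + 1)) :=
          mul_le_mul_of_nonneg_left (h1.trans (min_le_left _ _)) (norm_nonneg _)
      _ < (M + 1) * (ε / (M + 1)) := by
          gcongr
          linarith
      _ = ε := by field_simp
  obtain ⟨a, ha⟩ := cauchySeq_tendsto_of_complete hcau
  exact ⟨a, by simpa [HasProd] using! ha⟩

/-- The norms of the partial products are eventually constant, and the constant is the norm of a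
finite product of nonzero factors. -/
theorem IsUltrametricDist.tprod_one_add_ne_zero [CompleteSpace K] {f : ι → K}
    (hf : Tendsto f cofinite (𝓝 0)) (h0 : ∀ i, 1 + f i ≠ 0) : ∏' i, (1 + f i) ≠ 0 := by
  classical
  have hfin : {i | 1 ≤ ‖f i‖}.Finite := by
    simpa [Filter.eventually_cofinite] using Metric.tendsto_nhds.1 hf 1 one_pos
  have hs : ∀ i ∉ hfin.toFinset, ‖f i‖ < 1 := fun i hi ↦ by simpa using hi
  have h1 : Tendsto (fun s ↦ ‖∏ i ∈ s, (1 + f i)‖) atTop (𝓝 ‖∏' i, (1 + f i)‖) := by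
    have := (multipliable_one_add hf).hasProd.norm
    simpa [HasProd] using! this
  have h2 : Tendsto (fun s ↦ ‖∏ i ∈ s, (1 + f i)‖) atTop
      (𝓝 ‖∏ i ∈ hfin.toFinset, (1 + f i)‖) :=
    tendsto_const_nhds.congr' <| (Filter.eventually_ge_atTop hfin.toFinset).mono
      fun t ht ↦ (norm_prod_one_add_eq ht hs).symm
  rw [← norm_ne_zero_iff, tendsto_nhds_unique h1 h2, norm_ne_zero_iff]
  exact Finset.prod_ne_zero_iff.2 fun i _ ↦ h0 i

open Polynomial in
/-- The polynomial `∏_{v ∈ V} (Y - v)` of a finite group `V` is additive. -/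
theorem AddSubgroup.prod_sub_map_add {G K : Type*} [AddCommGroup G] [Field K] (V : AddSubgroup G)
    (s : Finset G) (hs : ∀ x, x ∈ s ↔ x ∈ V) (φ : G →+ K) (hφ : Function.Injective φ) (z w : K) :
    ∏ v ∈ s, (z + w - φ v) = ∏ v ∈ s, (z - φ v) + ∏ v ∈ s, (w - φ v) := by
  set P : K[X] := ∏ v ∈ s, (X - C (φ v))
  have hP (z : K) : P.eval z = ∏ v ∈ s, (z - φ v) := by simp [P, eval_prod]
  have hmon : P.Monic := monic_prod_of_monic _ _ fun v _ ↦ monic_X_sub_C _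
  have hdeg : P.natDegree = s.card := by simp [P]
  have htr (w : K) {v : G} (hv : v ∈ s) : P.eval (φ v + w) = P.eval w := by
    rw [hP, hP]
    refine Finset.prod_equiv (Equiv.subRight v) (fun u ↦ ?_) fun u _ ↦ ?_
    · simp only [hs, Equiv.subRight_apply] at *
      exact ⟨fun h ↦ sub_mem h hv, fun h ↦ by simpa using add_mem h hv⟩
    · simp only [Equiv.subRight_apply, map_sub]; ring
  have hcard : 0 < s.card := Finset.card_pos.2 ⟨0, (hs 0).2 V.zero_mem⟩
  have hz {v : G} (hv : v ∈ s) : P.eval (φ v) = 0 := by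
    rw [hP]; exact Finset.prod_eq_zero hv (sub_self _)
  -- Leading terms cancel, so `Q` has degree below `|V|`; it vanishes at the `|V|` points of `V`
  -- because `P` is `V`-periodic and zero on `V`.
  set Q : K[X] := P.comp (X + C w) - P - C (P.eval w)
  suffices hQ : Q = 0 by
    have := congr_arg (eval z) hQ
    simp only [Q, eval_sub, eval_comp, eval_add, eval_X, eval_C, hP, eval_zero] at this
    linear_combination this
  have hcomp : (P.comp (X + C w)).Monic := hmon.comp (monic_X_add_C w) (by simp)
  have h1 : Q.degree < s.card := by
    have hd : (P.comp (X + C w)).degree = P.degree := by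
      rw [degree_eq_natDegree hcomp.ne_zero, degree_eq_natDegree hmon.ne_zero, natDegree_comp]
      simp
    have h2 : (P.comp (X + C w) - P).degree < s.card := by
      rw [← hdeg, ← degree_eq_natDegree hmon.ne_zero, ← hd]
      exact degree_sub_lt_left hd hcomp.ne_zero (by rw [hcomp.leadingCoeff, hmon.leadingCoeff])
    refine (degree_sub_le _ _).trans_lt (max_lt h2 (degree_C_le.trans_lt ?_))
    exact_mod_cast hcard
  refine eq_zero_of_degree_lt_of_eval_index_eq_zero s hφ.injOn h1 fun v hv ↦ ?_
  simp [Q, eval_comp, htr w hv, hz hv]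
end Ultrametric

namespace Drinfeld

open Filter Topology

variable {F : Type*} [Field F] [Fintype F]

/-! ### The absolute value of `ℂ_∞`. -/

theorem norm_ofKInfty (x : KInfty F) : ‖ofKInfty x‖ = ‖x‖ := by
  change ‖((algebraMap (KInfty F) (KInftyAlgCl F) x : KInftyAlgCl F) : CInfty F)‖ = _
  rw [UniformSpace.Completion.norm_coe]
  exact spectralNorm_extends x

instance : IsUltrametricDist (KInftyAlgCl F) :=
  IsUltrametricDist.isUltrametricDist_of_isNonarchimedean_norm
    (isNonarchimedean_spectralNorm (K := KInfty F) (L := KInftyAlgCl F))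

instance : IsUltrametricDist (CInfty F) := by
  refine IsUltrametricDist.isUltrametricDist_of_isNonarchimedean_norm fun x y ↦ ?_
  induction x, y using UniformSpace.Completion.induction_on₂ with
  | hp => exact isClosed_le (by fun_prop) (by fun_prop)
  | ih x y =>
    rw [← UniformSpace.Completion.coe_add]
    simp only [UniformSpace.Completion.norm_coe]
    exact IsUltrametricDist.norm_add_le_max x y

theorem norm_algebraMap_ratFunc (x : RatFunc F) :
    ‖algebraMap (RatFunc F) (KInfty F) x‖ = WithZeroMulInt.toNNReal (one_lt_card F).ne_bot
      (@RatFunc.inftyValuation F _ (Classical.decEq _) x) := by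
  rw [← valued_KInfty_coe]
  change (Valued.v : Valuation (KInfty F) _).norm _ = _
  rw [Valuation.norm_def]
  change ((WithZeroMulInt.toNNReal (one_lt_card F).ne_bot
    (MonoidWithZeroHom.ValueGroup₀.embedding _) : ℝ≥0) : ℝ) = _
  rw [Valuation.embedding_restrict]

theorem norm_ofA {p : F[X]} (hp : p ≠ 0) : ‖ofA p‖ = (Fintype.card F : ℝ) ^ p.natDegree := by
  classical
  change ‖ofKInfty (algebraMap (RatFunc F) (KInfty F) (algebraMap F[X] (RatFunc F) p))‖ = _
  rw [norm_ofKInfty, norm_algebraMap_ratFunc, RatFunc.inftyValuation_apply,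
    RatFunc.inftyValuation.polynomial F hp,
    WithZeroMulInt.toNNReal_neg_apply _ (by simp)]
  change ((Fintype.card F : ℝ≥0) ^ (p.natDegree : ℤ) : ℝ≥0).toReal = _
  simp

theorem ofA_injective : Function.Injective (ofA (F := F)) :=
  (ofK (F := F)).injective.comp (IsFractionRing.injective F[X] (RatFunc F))

theorem norm_ofA_X : ‖ofA (Polynomial.X : F[X])‖ = Fintype.card F := by
  rw [norm_ofA Polynomial.X_ne_zero, Polynomial.natDegree_X, pow_one]

instance : NontriviallyNormedField (CInfty F) where
  toNormedField := inferInstance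
  non_trivial := ⟨ofA Polynomial.X, by
    rw [norm_ofA_X]; exact_mod_cast Fintype.one_lt_card⟩

/-! ### The lattice exponential `e_𝔟`. -/

theorem finite_degreeLT (d : ℕ) : {p : F[X] | p ∈ Polynomial.degreeLT F d}.Finite := by
  have : Finite (Polynomial.degreeLT F d) :=
    Finite.of_equiv _ (Polynomial.degreeLTEquiv F d).toEquiv.symm
  exact Set.toFinite (Polynomial.degreeLT F d : Set F[X])

theorem tendsto_div_ofA (𝔟 : AddSubgroup F[X]) (z : CInfty F) :
    Tendsto (fun b : {b : F[X] // b ∈ 𝔟 ∧ b ≠ 0} ↦ -(z / ofA (b : F[X]))) cofinite (𝓝 0) := by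
  rw [Metric.tendsto_nhds]
  intro ε hε
  have hq : (1 : ℝ) < Fintype.card F := by exact_mod_cast Fintype.one_lt_card
  obtain ⟨d, hd⟩ := pow_unbounded_of_one_lt (‖z‖ / ε) hq
  rw [eventually_cofinite]
  refine ((finite_degreeLT (F := F) d).preimage Subtype.val_injective.injOn).subset ?_
  rintro ⟨b, hb, hb0⟩ h
  rw [Set.mem_preimage, Set.mem_ofPred_eq, Polynomial.mem_degreeLT,
    ← Polynomial.natDegree_lt_iff_degree_lt hb0]
  by_contra! hdb
  refine h ?_
  have hpow : (Fintype.card F : ℝ) ^ d ≤ (Fintype.card F : ℝ) ^ b.natDegree :=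
    pow_le_pow_right₀ hq.le hdb
  rw [dist_zero_right, norm_neg, norm_div, norm_ofA hb0, div_lt_iff₀ (by positivity)]
  rw [div_lt_iff₀ hε] at hd
  nlinarith

theorem multipliable_expo (𝔟 : AddSubgroup F[X]) (z : CInfty F) :
    Multipliable fun b : {b : F[X] // b ∈ 𝔟 ∧ b ≠ 0} ↦ 1 - z / ofA (b : F[X]) := by
  simpa only [sub_eq_add_neg] using IsUltrametricDist.multipliable_one_add (tendsto_div_ofA 𝔟 z)

theorem expo_ne_zero (𝔟 : AddSubgroup F[X]) {z : CInfty F} (hz : ∀ b ∈ 𝔟, z ≠ ofA b) :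
    expo 𝔟 z ≠ 0 := by
  refine mul_ne_zero (by simpa using hz 0 𝔟.zero_mem) ?_
  simp only [sub_eq_add_neg]
  refine IsUltrametricDist.tprod_one_add_ne_zero (tendsto_div_ofA 𝔟 z) ?_
  rintro ⟨b, hb, hb0⟩ h
  have hb' : ofA b ≠ 0 := by rwa [Ne, map_eq_zero_iff _ ofA_injective]
  refine hz b hb ?_
  rw [← sub_eq_add_neg, sub_eq_zero, eq_comm, div_eq_one_iff_eq hb'] at h
  exact h

theorem expo_ofA {𝔟 : AddSubgroup F[X]} {b : F[X]} (hb : b ∈ 𝔟) : expo 𝔟 (ofA b) = 0 := by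
  by_cases hb0 : b = 0
  · simp [expo, hb0]
  have hb' : ofA b ≠ 0 := by rwa [Ne, map_eq_zero_iff _ ofA_injective]
  rw [expo, mul_eq_zero]
  right
  exact tprod_of_exists_eq_zero ⟨⟨b, hb, hb0⟩, by simp [div_self hb']⟩

/-- `e_A` is the limit of the additive polynomials attached to `{a ∈ A | deg a < d}`. -/
theorem tendsto_expo_top : ∃ (c : ℕ → CInfty F), ∀ z, Tendsto (fun d ↦
    c d * ∏ b ∈ (finite_degreeLT (F := F) d).toFinset, (z - ofA b)) atTop (𝓝 (expo ⊤ z)) := by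
  classical
  let S (d : ℕ) : Finset {b : F[X] // b ∈ (⊤ : AddSubgroup F[X]) ∧ b ≠ 0} :=
    (finite_degreeLT (F := F) d).toFinset.subtype _
  have hS : Tendsto S atTop atTop := by
    refine tendsto_atTop_finset_of_monotone (fun d e hde b hb ↦ ?_) fun b ↦ ?_
    · simp only [S, Finset.mem_subtype, Set.Finite.mem_toFinset, Set.mem_ofPred_eq] at hb ⊢
      exact Polynomial.degreeLT_mono hde hb
    · refine ⟨(b : F[X]).natDegree + 1, ?_⟩
      simp only [S, Finset.mem_subtype, Set.Finite.mem_toFinset, Set.mem_ofPred_eq,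
        Polynomial.mem_degreeLT]
      rw [← Polynomial.natDegree_lt_iff_degree_lt b.2.2]
      exact Nat.lt_succ_self _
  -- The constant converts each factor `z - b` with `b ≠ 0` into `1 - z / b`; the factor for `b = 0`
  -- supplies the leading `z`.
  refine ⟨fun d ↦ ∏ b ∈ S d, (-(ofA (b : F[X]))⁻¹), fun z ↦ ?_⟩
  have h := ((multipliable_expo (⊤ : AddSubgroup F[X]) z).hasProd)
  have h1 : Tendsto (fun s : Finset {b : F[X] // b ∈ (⊤ : AddSubgroup F[X]) ∧ b ≠ 0} ↦
    ∏ b ∈ s, (1 - z / ofA (b : F[X]))) atTop (𝓝 (∏' b : {b : F[X] // b ∈ (⊤ : AddSubgroup F[X]) ∧ b ≠ 0}, (1 - z / ofA (b : F[X])))) := by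
    simpa [HasProd] using! h
  refine ((h1.comp hS).const_mul z).congr fun d ↦ ?_
  have h0 : (0 : F[X]) ∈ (finite_degreeLT (F := F) d).toFinset := by simp
  rw [← Finset.mul_prod_erase _ _ h0]
  have h2 : ∏ b ∈ (finite_degreeLT (F := F) d).toFinset.erase 0, (z - ofA b) =
      ∏ b ∈ S d, (z - ofA (b : F[X])) := by
    rw [Finset.prod_subtype_eq_prod_filter (f := fun b ↦ z - ofA b)]
    congr 1
    ext b
    simp [and_comm]
  rw [h2, map_zero, sub_zero, mul_left_comm, ← Finset.prod_mul_distrib, Function.comp]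
  congr 1
  refine Finset.prod_congr rfl fun b _ ↦ ?_
  have hb' : ofA (b : F[X]) ≠ 0 := by rw [Ne, map_eq_zero_iff _ ofA_injective]; exact b.2.2
  field_simp
  ring

/-- Additivity passes to the limit from the polynomials attached to the finite groups of `a ∈ A`
with `deg a < d`. -/
theorem expo_top_add (z w : CInfty F) : expo ⊤ (z + w) = expo ⊤ z + expo ⊤ w := by
  obtain ⟨c, hc⟩ := tendsto_expo_top (F := F)
  refine tendsto_nhds_unique (hc (z + w)) (((hc z).add (hc w)).congr fun d ↦ ?_)
  rw [← mul_add]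
  congr 1
  exact (AddSubgroup.prod_sub_map_add (Polynomial.degreeLT F d).toAddSubgroup _ (by simp)
    (ofA (F := F)).toAddMonoidHom ofA_injective z w).symm

variable (F) in
/-- The ideal `(t^m)`, as a group. -/
def tpow (m : ℕ) : AddSubgroup F[X] := (Ideal.span {(Polynomial.X : F[X]) ^ m}).toAddSubgroup

omit [Fintype F] in
theorem mem_tpow {m : ℕ} {b : F[X]} : b ∈ tpow F m ↔ Polynomial.X ^ m ∣ b := by
  rw [← Ideal.mem_span_singleton]; rfl

/-- Multiplication by `t^m` carries the lattice `A` to `(t^m)`. This reduces every uniformizer in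
use to the single additive function `e_A`. -/
theorem expo_tpow (m : ℕ) (z : CInfty F) :
    expo (tpow F m) z = ofA Polynomial.X ^ m * expo ⊤ (z / ofA Polynomial.X ^ m) := by
  have hT : ofA (Polynomial.X : F[X]) ≠ 0 := by
    rw [Ne, map_eq_zero_iff _ ofA_injective]; exact Polynomial.X_ne_zero
  have hX : (Polynomial.X : F[X]) ^ m ≠ 0 := pow_ne_zero _ Polynomial.X_ne_zero
  rw [expo, expo, ← mul_assoc, mul_div_cancel₀ _ (pow_ne_zero _ hT)]
  congr 1
  let e : {b : F[X] // b ∈ (⊤ : AddSubgroup F[X]) ∧ b ≠ 0} ≃ {b : F[X] // b ∈ tpow F m ∧ b ≠ 0} :=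
    Equiv.ofBijective (fun b ↦ ⟨Polynomial.X ^ m * (b : F[X]), mem_tpow.2 (dvd_mul_right _ _),
      mul_ne_zero hX b.2.2⟩) ⟨fun b c h ↦ Subtype.ext (mul_left_cancel₀ hX (congr_arg Subtype.val h)),
      by
        rintro ⟨b, hb, hb0⟩
        obtain ⟨c, rfl⟩ := mem_tpow.1 hb
        exact ⟨⟨c, trivial, right_ne_zero_of_mul hb0⟩, rfl⟩⟩
  rw [← e.tprod_eq]
  refine tprod_congr fun b ↦ ?_
  have he : ofA (e b : F[X]) = ofA Polynomial.X ^ m * ofA (b : F[X]) := by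
    rw [← map_pow, ← map_mul]; rfl
  rw [he, div_div]

/-! ### The slash action and the matrices `(1 b; 0 t)`, `(t 0; 0 1)`. -/

theorem moebius_mul (γ δ : GL (Fin 2) (RatFunc F)) (z : Omega F) :
    moebius (γ * δ) z = moebius γ (moebius δ z) := by
  apply Subtype.ext
  have h1 := den_ne_zero δ z
  have h2 := den_ne_zero (γ * δ) z
  have h3 := den_ne_zero γ (moebius δ z)
  simp only [moebius, Units.val_mul, Matrix.mul_apply, Fin.sum_univ_two, map_add, map_mul] at *
  rw [div_eq_div_iff h2 h3]
  field_simp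
  ring

theorem slash_apply (k : ℤ) (γ : GL (Fin 2) (RatFunc F)) (f : Omega F → CInfty F) (z : Omega F) :
    slash k γ f z = ofK (γ 0 0 * γ 1 1 - γ 0 1 * γ 1 0) ^ (k - 1) *
      (ofK (γ 1 0) * (z : CInfty F) + ofK (γ 1 1)) ^ (-k) * f (moebius γ z) := rfl

theorem slash_mul (k : ℤ) (γ δ : GL (Fin 2) (RatFunc F)) (f : Omega F → CInfty F) :
    slash k (γ * δ) f = slash k δ (slash k γ f) := by
  ext z
  simp only [slash_apply, moebius_mul]
  have h1 := den_ne_zero δ z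
  have hden : ofK ((γ * δ) 1 0) * (z : CInfty F) + ofK ((γ * δ) 1 1) =
      (ofK (γ 1 0) * (moebius δ z : CInfty F) + ofK (γ 1 1)) *
        (ofK (δ 1 0) * (z : CInfty F) + ofK (δ 1 1)) := by
    simp only [moebius, Units.val_mul, Matrix.mul_apply, Fin.sum_univ_two, map_add, map_mul]
    field_simp
    ring
  have hdet : (γ * δ) 0 0 * (γ * δ) 1 1 - (γ * δ) 0 1 * (γ * δ) 1 0 =
      (γ 0 0 * γ 1 1 - γ 0 1 * γ 1 0) * (δ 0 0 * δ 1 1 - δ 0 1 * δ 1 0) := by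
    simp only [Units.val_mul, Matrix.mul_apply, Fin.sum_univ_two]
    ring
  rw [hden, hdet, map_mul, mul_zpow, mul_zpow]
  ring

omit [Fintype F] in
theorem slToGL_apply (γ : SL(2, F[X])) (i j : Fin 2) :
    slToGL γ i j = algebraMap F[X] (RatFunc F) (γ i j) := rfl

theorem ofK_algebraMap (a : F[X]) : ofK (algebraMap F[X] (RatFunc F) a) = ofA a := rfl

omit [Fintype F] in
theorem det_slToGL (γ : SL(2, F[X])) :
    slToGL γ 0 0 * slToGL γ 1 1 - slToGL γ 0 1 * slToGL γ 1 0 = 1 := by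
  simp only [slToGL_apply, ← map_mul, ← map_sub]
  rw [← Matrix.det_fin_two, γ.det_coe, map_one]

theorem slash_slToGL_apply (k : ℤ) (γ : SL(2, F[X])) (f : Omega F → CInfty F) (z : Omega F) :
    slash k (slToGL γ) f z = (ofA (γ 1 0) * (z : CInfty F) + ofA (γ 1 1)) ^ (-k) *
      f (moebius (slToGL γ) z) := by
  rw [slash_apply, det_slToGL, map_one, one_zpow, one_mul]
  rfl

theorem den_slToGL_ne_zero (γ : SL(2, F[X])) (z : Omega F) :
    ofA (γ 1 0) * (z : CInfty F) + ofA (γ 1 1) ≠ 0 := den_ne_zero (slToGL γ) z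

theorem slash_eq_self_iff {k : ℤ} {γ : SL(2, F[X])} {f : Omega F → CInfty F} :
    slash k (slToGL γ) f = f ↔ ∀ z : Omega F, f (moebius (slToGL γ) z) =
      (ofA (γ 1 0) * (z : CInfty F) + ofA (γ 1 1)) ^ k * f z := by
  rw [funext_iff]
  refine forall_congr' fun z ↦ ?_
  have := zpow_ne_zero k (den_slToGL_ne_zero γ z)
  rw [slash_slToGL_apply, zpow_neg, inv_mul_eq_iff_eq_mul₀ this]

variable (F) in
/-- The matrix `(t 0; 0 1)`. -/
def scaleGL : GL (Fin 2) (RatFunc F) :=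
  Matrix.GeneralLinearGroup.mkOfDetNeZero !![algebraMap F[X] (RatFunc F) Polynomial.X, 0; 0, 1]
    (by simp [Matrix.det_fin_two, -RatFunc.algebraMap_X])

/-- The matrix `(1 b; 0 t)`. -/
def shiftGL (b : F[X]) : GL (Fin 2) (RatFunc F) :=
  Matrix.GeneralLinearGroup.mkOfDetNeZero
    !![1, algebraMap F[X] (RatFunc F) b; 0, algebraMap F[X] (RatFunc F) Polynomial.X]
    (by simp [Matrix.det_fin_two, -RatFunc.algebraMap_X])

omit [Fintype F] in
theorem coe_scaleGL : (scaleGL F : Matrix (Fin 2) (Fin 2) (RatFunc F)) =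
    !![algebraMap F[X] (RatFunc F) Polynomial.X, 0; 0, 1] := rfl

omit [Fintype F] in
theorem coe_shiftGL (b : F[X]) : (shiftGL b : Matrix (Fin 2) (Fin 2) (RatFunc F)) =
    !![1, algebraMap F[X] (RatFunc F) b; 0, algebraMap F[X] (RatFunc F) Polynomial.X] := rfl

theorem ofA_X_ne_zero : ofA (Polynomial.X : F[X]) ≠ 0 := by
  rw [Ne, map_eq_zero_iff _ ofA_injective]; exact Polynomial.X_ne_zero

theorem moebius_shiftGL (b : F[X]) (z : Omega F) :
    (moebius (shiftGL b) z : CInfty F) = ((z : CInfty F) + ofA b) / ofA Polynomial.X := by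
  simp [moebius, coe_shiftGL, -RatFunc.algebraMap_X, ofK_algebraMap]

theorem slash_shiftGL (k : ℤ) (b : F[X]) (f : Omega F → CInfty F) (z : Omega F) :
    slash k (shiftGL b) f z = (ofA Polynomial.X)⁻¹ * f (moebius (shiftGL b) z) := by
  rw [slash_apply]
  have : ofA (Polynomial.X : F[X]) ^ (k - 1) * ofA (Polynomial.X : F[X]) ^ (-k) =
      (ofA Polynomial.X)⁻¹ := by
    rw [← zpow_add₀ ofA_X_ne_zero, ← zpow_neg_one]; congr 1; ring
  rw [← this]
  simp [coe_shiftGL, -RatFunc.algebraMap_X, ofK_algebraMap]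

theorem moebius_scaleGL (z : Omega F) :
    (moebius (scaleGL F) z : CInfty F) = ofA Polynomial.X * (z : CInfty F) := by
  simp [moebius, coe_scaleGL, -RatFunc.algebraMap_X, ofK_algebraMap]

theorem slash_scaleGL (k : ℤ) (f : Omega F → CInfty F) (z : Omega F) :
    slash k (scaleGL F) f z = ofA Polynomial.X ^ (k - 1) * f (moebius (scaleGL F) z) := by
  rw [slash_apply]
  simp [coe_scaleGL, -RatFunc.algebraMap_X, ofK_algebraMap]

/-- `∑_β f|_k (1 β; 0 t)`, over `β ∈ 𝔽_q`. -/
def shiftSum (k : ℤ) : Module.End (CInfty F) (Omega F → CInfty F) :=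
  ∑ β : F, slash k (shiftGL (Polynomial.C β))

theorem shiftSum_apply (k : ℤ) (f : Omega F → CInfty F) :
    shiftSum k f = ∑ β : F, slash k (shiftGL (Polynomial.C β)) f := by
  simp [shiftSum]

/-! ### Commutation relations in `GL₂(K)`, and `U_t` as a finite sum. -/

section Entries

variable {R : Type*} [CommRing R]

theorem exists_sl2 {a b c d : R} (h : a * d - b * c = 1) :
    ∃ μ : SL(2, R), μ 0 0 = a ∧ μ 0 1 = b ∧ μ 1 0 = c ∧ μ 1 1 = d :=
  ⟨⟨!![a, b; c, d], by rwa [Matrix.det_fin_two]⟩, rfl, rfl, rfl, rfl⟩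

theorem sl2_det (ν : SL(2, R)) : ν 0 0 * ν 1 1 - ν 0 1 * ν 1 0 = 1 := by
  rw [← Matrix.det_fin_two]; exact ν.det_coe

theorem sl2_mul_apply (μ ν : SL(2, R)) (i j : Fin 2) :
    (μ * ν) i j = μ i 0 * ν 0 j + μ i 1 * ν 1 j := by
  rw [Matrix.SpecialLinearGroup.coe_mul, Matrix.mul_apply, Fin.sum_univ_two]

theorem sl2_inv_apply (ν : SL(2, R)) : (ν⁻¹) 0 0 = ν 1 1 ∧ (ν⁻¹) 0 1 = -ν 0 1 ∧
    (ν⁻¹) 1 0 = -ν 1 0 ∧ (ν⁻¹) 1 1 = ν 0 0 := by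
  rw [Matrix.SpecialLinearGroup.SL2_inv_expl]
  exact ⟨rfl, rfl, rfl, rfl⟩

theorem gl2_mul_apply (γ δ : GL (Fin 2) R) (i j : Fin 2) :
    (γ * δ) i j = γ i 0 * δ 0 j + γ i 1 * δ 1 j := by
  rw [Units.val_mul, Matrix.mul_apply, Fin.sum_univ_two]

theorem gl2_ext {γ δ : GL (Fin 2) R} (h00 : γ 0 0 = δ 0 0) (h01 : γ 0 1 = δ 0 1)
    (h10 : γ 1 0 = δ 1 0) (h11 : γ 1 1 = δ 1 1) : γ = δ := by
  refine Units.ext (Matrix.ext fun i j ↦ ?_)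
  fin_cases i <;> fin_cases j <;> assumption

end Entries

omit [Fintype F] in
theorem shiftGL_apply (b : F[X]) : shiftGL b 0 0 = 1 ∧
    shiftGL b 0 1 = algebraMap F[X] (RatFunc F) b ∧ shiftGL b 1 0 = 0 ∧
    shiftGL b 1 1 = algebraMap F[X] (RatFunc F) Polynomial.X := ⟨rfl, rfl, rfl, rfl⟩

omit [Fintype F] in
theorem scaleGL_apply : scaleGL F 0 0 = algebraMap F[X] (RatFunc F) Polynomial.X ∧
    scaleGL F 0 1 = 0 ∧ scaleGL F 1 0 = 0 ∧ scaleGL F 1 1 = 1 := ⟨rfl, rfl, rfl, rfl⟩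

omit [Fintype F] in
/-- Commuting `(1 β; 0 t)` past `ν ∈ SL₂(A)`, when the quotient is upper triangular with
diagonal `(1, t)`. -/
theorem exists_shiftGL_mul (ν : SL(2, F[X])) (β b : F[X])
    (h : Polynomial.X ∣ ν 0 1 + β * ν 1 1 - (ν 0 0 + β * ν 1 0) * b) :
    ∃ μ : SL(2, F[X]), μ 0 0 = ν 0 0 + β * ν 1 0 ∧ μ 1 0 = Polynomial.X * ν 1 0 ∧
      μ 1 1 = ν 1 1 - ν 1 0 * b ∧ shiftGL β * slToGL ν = slToGL μ * shiftGL b := by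
  obtain ⟨y, hy⟩ := h
  obtain ⟨μ, h00, h01, h10, h11⟩ := exists_sl2 (a := ν 0 0 + β * ν 1 0) (b := y)
    (c := Polynomial.X * ν 1 0) (d := ν 1 1 - ν 1 0 * b)
    (by linear_combination sl2_det ν + ν 1 0 * hy)
  refine ⟨μ, h00, h10, h11, ?_⟩
  have hy' := congr_arg (algebraMap F[X] (RatFunc F)) hy
  simp only [map_sub, map_add, map_mul] at hy'
  obtain ⟨s00, s01, s10, s11⟩ := shiftGL_apply β
  obtain ⟨t00, t01, t10, t11⟩ := shiftGL_apply b
  apply gl2_ext <;> simp only [gl2_mul_apply, slToGL_apply, h00, h01, h10, h11, s00, s01, s10, s11,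
    t00, t01, t10, t11, map_add, map_sub, map_mul]
  · ring
  · linear_combination hy'
  · ring
  · ring

omit [Fintype F] in
/-- Commuting `(1 β; 0 t)` past `ν ∈ SL₂(A)`, when the quotient is upper triangular with
diagonal `(t, 1)`. -/
theorem exists_shiftGL_mul_eq_scaleGL (ν : SL(2, F[X])) (β : F[X])
    (h : Polynomial.X ∣ ν 0 0 + β * ν 1 0) :
    ∃ μ : SL(2, F[X]), μ 1 0 = ν 1 0 ∧ shiftGL β * slToGL ν = slToGL μ * scaleGL F := by
  obtain ⟨x, hx⟩ := h
  obtain ⟨μ, h00, h01, h10, h11⟩ := exists_sl2 (a := x) (b := ν 0 1 + β * ν 1 1)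
    (c := ν 1 0) (d := Polynomial.X * ν 1 1) (by linear_combination sl2_det ν - ν 1 1 * hx)
  refine ⟨μ, h10, ?_⟩
  have hx' := congr_arg (algebraMap F[X] (RatFunc F)) hx
  simp only [map_add, map_mul] at hx'
  obtain ⟨s00, s01, s10, s11⟩ := shiftGL_apply β
  obtain ⟨t00, t01, t10, t11⟩ := scaleGL_apply (F := F)
  apply gl2_ext <;> simp only [gl2_mul_apply, slToGL_apply, h00, h01, h10, h11, s00, s01, s10, s11,
    t00, t01, t10, t11, map_add, map_mul]
  · linear_combination hx'
  · ring
  · ring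
  · ring

omit [Fintype F] in
/-- `(1 β; 0 t)` normalises the left `Γ₁(t^n)`-cosets of a matrix in `Γ₀(t^n)`. -/
theorem exists_shiftGL_mul_of_dvd {n : ℕ} (hn : n ≠ 0) {ν : SL(2, F[X])}
    (hν : Polynomial.X ^ n ∣ ν 1 0) (β : F) :
    ∃ γ ∈ Gamma1 (Polynomial.X ^ n), shiftGL (Polynomial.C β) * slToGL ν =
      slToGL (γ * ν) * shiftGL (Polynomial.C
        ((ν 1 1).coeff 0 * ((ν 0 1).coeff 0 + β * (ν 1 1).coeff 0))) := by
  have hdet := sl2_det ν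
  have hX : Polynomial.X ∣ ν 1 0 := (dvd_pow_self _ hn).trans hν
  have h0 : (ν 1 0).coeff 0 = 0 := Polynomial.X_dvd_iff.1 hX
  have hdet0 : (ν 0 0).coeff 0 * (ν 1 1).coeff 0 = 1 := by
    simpa [Polynomial.mul_coeff_zero, h0] using congr_arg (fun p : F[X] ↦ p.coeff 0) hdet
  -- Modulo `t` the diagonal entries of `ν` are inverse to each other, so multiplying by the lower
  -- right one solves the required congruence for `b`.
  obtain ⟨μ, h1, h2, h3, h4⟩ := exists_shiftGL_mul ν (Polynomial.C β)
    (Polynomial.C ((ν 1 1).coeff 0 * ((ν 0 1).coeff 0 + β * (ν 1 1).coeff 0))) (by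
      rw [Polynomial.X_dvd_iff]
      simp only [Polynomial.coeff_sub, Polynomial.coeff_add, Polynomial.mul_coeff_zero,
        Polynomial.coeff_C_zero, h0]
      linear_combination -((ν 0 1).coeff 0 + β * (ν 1 1).coeff 0) * hdet0)
  refine ⟨μ * ν⁻¹, ?_, by rw [inv_mul_cancel_right, h4]⟩
  obtain ⟨c, hc⟩ := hν
  obtain ⟨i00, i01, i10, i11⟩ := sl2_inv_apply ν
  change _ ∣ _ ∧ _ ∣ _ ∧ _ ∣ _
  rw [sl2_mul_apply, sl2_mul_apply, sl2_mul_apply, i00, i01, i10, i11]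
  set b := Polynomial.C ((ν 1 1).coeff 0 * ((ν 0 1).coeff 0 + β * (ν 1 1).coeff 0))
  refine ⟨⟨(ν 0 1 + Polynomial.C β * ν 1 1 - μ 0 1) * c, ?_⟩,
    ⟨(Polynomial.X * ν 1 1 - μ 1 1) * c, ?_⟩,
    ⟨(ν 0 1 - Polynomial.X * ν 0 1 - ν 0 0 * b) * c, ?_⟩⟩
  · rw [h1]
    linear_combination hdet + (ν 0 1 + Polynomial.C β * ν 1 1 - μ 0 1) * hc
  · rw [h2]
    linear_combination (Polynomial.X * ν 1 1 - μ 1 1) * hc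
  · rw [h2, h3]
    linear_combination hdet + (ν 0 1 - Polynomial.X * ν 0 1 - ν 0 0 * b) * hc

/-- `f` is invariant under `Γ₁(𝔫)` in weight `k`. -/
def IsInvariant (𝔫 : F[X]) (k : ℤ) (f : Omega F → CInfty F) : Prop :=
  ∀ γ ∈ Gamma1 𝔫, slash k (slToGL γ) f = f

/-- Moving `ν` past the representatives only permutes the `β` by an affine bijection of `𝔽_q`, up to
left factors in `Γ₁(t^n)` which `f` absorbs. -/
theorem slash_shiftSum {n : ℕ} (hn : n ≠ 0) {k : ℤ} {f : Omega F → CInfty F}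
    (hf : IsInvariant (Polynomial.X ^ n) k f) {ν : SL(2, F[X])}
    (hν : Polynomial.X ^ n ∣ ν 1 0) :
    slash k (slToGL ν) (shiftSum k f) = shiftSum k (slash k (slToGL ν) f) := by
  have hdet := sl2_det ν
  have h0 : (ν 1 0).coeff 0 = 0 := Polynomial.X_dvd_iff.1 ((dvd_pow_self _ hn).trans hν)
  have hdet0 : (ν 0 0).coeff 0 * (ν 1 1).coeff 0 = 1 := by
    simpa [Polynomial.mul_coeff_zero, h0] using congr_arg (fun p : F[X] ↦ p.coeff 0) hdet
  have hw : (ν 1 1).coeff 0 ≠ 0 := right_ne_zero_of_mul_eq_one hdet0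
  have hbij : Function.Bijective fun β : F ↦
      (ν 1 1).coeff 0 * ((ν 0 1).coeff 0 + β * (ν 1 1).coeff 0) := by
    rw [Finite.injective_iff_bijective.symm]
    intro β β' h
    simpa [hw] using h
  rw [shiftSum_apply, shiftSum_apply, map_sum]
  refine Fintype.sum_bijective _ hbij _ _ fun β ↦ ?_
  obtain ⟨γ, hγ, h⟩ := exists_shiftGL_mul_of_dvd hn hν β
  rw [← slash_mul, h, slash_mul, map_mul slToGL, slash_mul, hf γ hγ]

theorem IsInvariant.shiftSum {n : ℕ} (hn : n ≠ 0) {k : ℤ} {f : Omega F → CInfty F}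
    (hf : IsInvariant (Polynomial.X ^ n) k f) :
    IsInvariant (Polynomial.X ^ n) k (shiftSum k f) := fun γ hγ ↦ by
  rw [slash_shiftSum hn hf hγ.2.1, hf γ hγ]

omit [Fintype F] in
theorem diagGL_apply (𝔪 : F[X]) (h : 𝔪 ≠ 0) : diagGL 𝔪 h 0 0 = 1 ∧ diagGL 𝔪 h 0 1 = 0 ∧
    diagGL 𝔪 h 1 0 = 0 ∧ diagGL 𝔪 h 1 1 = algebraMap F[X] (RatFunc F) 𝔪 := ⟨rfl, rfl, rfl, rfl⟩

omit [Fintype F] in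
theorem transl_apply (b : F[X]) : transl b 0 0 = 1 ∧ transl b 0 1 = b ∧ transl b 1 0 = 0 ∧
    transl b 1 1 = 1 := ⟨rfl, rfl, rfl, rfl⟩

omit [Fintype F] in
theorem shiftGL_C_eq (β : F) : shiftGL (Polynomial.C β) =
    diagGL Polynomial.X Polynomial.X_ne_zero * slToGL (transl (Polynomial.C β)) := by
  have h := diagGL_apply (F := F) Polynomial.X Polynomial.X_ne_zero
  obtain ⟨h00, h01, h10, h11⟩ := h
  obtain ⟨s00, s01, s10, s11⟩ := shiftGL_apply (Polynomial.C β)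
  obtain ⟨t00, t01, t10, t11⟩ := transl_apply (Polynomial.C β)
  apply gl2_ext <;> simp only [gl2_mul_apply, slToGL_apply, h00, h01, h10, h11, s00, s01, s10, s11,
    t00, t01, t10, t11, map_one, map_zero] <;> ring

omit [Fintype F] in
theorem transl_mem_Gamma1 (𝔫 b : F[X]) : transl b ∈ Gamma1 𝔫 := by
  change _ ∣ _ ∧ _ ∣ _ ∧ _ ∣ _
  simp [transl]

omit [Fintype F] in
theorem shiftGL_zero : shiftGL (0 : F[X]) = diagGL Polynomial.X Polynomial.X_ne_zero := by
  refine Units.ext ?_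
  rw [coe_shiftGL, map_zero]
  rfl

omit [Fintype F] in
/-- Representatives of `Γ₁(t^n) \ Γ₁(t^n) (1 0; 0 t) Γ₁(t^n)`. -/
theorem image_doubleCoset {n : ℕ} (hn : n ≠ 0) :
    let Γ := (Gamma1 ((Polynomial.X : F[X]) ^ n)).map slToGL
    Quotient.mk (QuotientGroup.rightRel Γ) ''
      (DoubleCoset.doubleCoset (diagGL Polynomial.X Polynomial.X_ne_zero) Γ Γ) =
    Set.range fun β : F ↦ Quotient.mk (QuotientGroup.rightRel Γ) (shiftGL (Polynomial.C β)) := by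
  intro Γ
  ext ξ
  constructor
  · rintro ⟨_, h, rfl⟩
    obtain ⟨_, ⟨γ, hγ, rfl⟩, _, ⟨δ, hδ, rfl⟩, rfl⟩ := DoubleCoset.mem_doubleCoset.1 h
    obtain ⟨μ, hμ, h⟩ := exists_shiftGL_mul_of_dvd hn hδ.2.1 (0 : F)
    refine ⟨(δ 1 1).coeff 0 * ((δ 0 1).coeff 0 + 0 * (δ 1 1).coeff 0), Quotient.sound ?_⟩
    rw [map_zero, shiftGL_zero] at h
    change QuotientGroup.rightRel Γ _ _
    rw [QuotientGroup.rightRel_apply, mul_assoc _ _ (slToGL δ), h, ← mul_assoc, mul_inv_cancel_right]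
    exact mul_mem ⟨γ, hγ, rfl⟩ ⟨_, mul_mem hμ hδ, rfl⟩
  · rintro ⟨β, rfl⟩
    refine ⟨_, DoubleCoset.mem_doubleCoset.2 ⟨1, one_mem _, _,
      ⟨_, transl_mem_Gamma1 _ (Polynomial.C β), rfl⟩, ?_⟩, rfl⟩
    rw [one_mul, shiftGL_C_eq]

omit [Fintype F] in
-- If `γ (1 β; 0 t) = (1 β'; 0 t)`, then the upper left entry of `γ` is `1`, so `β' - β` is
-- divisible by `t`.
theorem shiftGL_injective_mod (n : ℕ) : Function.Injective fun β : F ↦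
    Quotient.mk (QuotientGroup.rightRel ((Gamma1 ((Polynomial.X : F[X]) ^ n)).map slToGL))
      (shiftGL (Polynomial.C β)) := by
  intro β β' h
  have h1 : QuotientGroup.rightRel ((Gamma1 ((Polynomial.X : F[X]) ^ n)).map slToGL) _ _ :=
    Quotient.exact h
  rw [QuotientGroup.rightRel_apply] at h1
  obtain ⟨γ, -, hγ⟩ := h1
  have h2 : slToGL γ * shiftGL (Polynomial.C β) = shiftGL (Polynomial.C β') := by
    rw [hγ, inv_mul_cancel_right]
  obtain ⟨s00, s01, s10, s11⟩ := shiftGL_apply (Polynomial.C β)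
  obtain ⟨t00, t01, t10, t11⟩ := shiftGL_apply (Polynomial.C β')
  have h00 : (slToGL γ * shiftGL (Polynomial.C β)) 0 0 = shiftGL (Polynomial.C β') 0 0 := by
    rw [h2]
  have h01 : (slToGL γ * shiftGL (Polynomial.C β)) 0 1 = shiftGL (Polynomial.C β') 0 1 := by
    rw [h2]
  rw [gl2_mul_apply, s00, s10, t00, mul_one, mul_zero, add_zero] at h00
  rw [gl2_mul_apply, s01, s11, t01, h00, one_mul, slToGL_apply, ← map_mul, ← map_add] at h01
  have h3 := IsFractionRing.injective F[X] (RatFunc F) h01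
  simpa [Polynomial.mul_coeff_zero] using congr_arg (fun p : F[X] ↦ p.coeff 0) h3

/-- The representatives chosen by `Quotient.out` differ from the `(1 β; 0 t)` by left factors in
`Γ₁(t^n)`, which do not change the slash of an invariant `f`. -/
theorem Ut_apply {n : ℕ} (hn : n ≠ 0) {k : ℤ} {f : Omega F → CInfty F}
    (hf : IsInvariant (Polynomial.X ^ n) k f) : Ut n k f = shiftSum k f := by
  rw [Ut, hecke, image_doubleCoset hn, finsum_mem_range (shiftGL_injective_mod n),
    finsum_eq_sum_of_fintype, LinearMap.sum_apply, shiftSum_apply]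
  refine Finset.sum_congr rfl fun β _ ↦ ?_
  set Γ := (Gamma1 ((Polynomial.X : F[X]) ^ n)).map slToGL
  have h : QuotientGroup.rightRel Γ _ _ :=
    Quotient.mk_out (s := QuotientGroup.rightRel Γ) (shiftGL (Polynomial.C β))
  rw [QuotientGroup.rightRel_apply] at h
  obtain ⟨γ, hγ, h⟩ := h
  rw [eq_mul_inv_iff_mul_eq] at h
  conv_rhs => rw [← h, slash_mul, hf γ hγ]

/-! ### Rigid analyticity of `U_t f`. -/

theorem IsRigidAnalytic.add {f g : Omega F → CInfty F} (hf : IsRigidAnalytic f)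
    (hg : IsRigidAnalytic g) : IsRigidAnalytic (f + g) := fun m ε hε ↦ by
  obtain ⟨P, Q, hQ, hP⟩ := hf m ε hε
  obtain ⟨P', Q', hQ', hP'⟩ := hg m ε hε
  refine ⟨P * Q' + P' * Q, Q * Q', fun z hz ↦ by simpa using ⟨hQ z hz, hQ' z hz⟩, fun z hz ↦ ?_⟩
  have h1 := hQ z hz
  have h2 := hQ' z hz
  have : (f + g) z - (P * Q' + P' * Q).eval (z : CInfty F) / (Q * Q').eval (z : CInfty F) =
      (f z - P.eval (z : CInfty F) / Q.eval (z : CInfty F)) +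
      (g z - P'.eval (z : CInfty F) / Q'.eval (z : CInfty F)) := by
    simp only [Pi.add_apply, Polynomial.eval_add, Polynomial.eval_mul]
    field_simp
    ring
  rw [this]
  exact (IsUltrametricDist.norm_add_le_max _ _).trans (max_le (hP z hz) (hP' z hz))

theorem IsRigidAnalytic.sum {ι : Type*} (s : Finset ι) {f : ι → Omega F → CInfty F}
    (hf : ∀ i ∈ s, IsRigidAnalytic (f i)) : IsRigidAnalytic (∑ i ∈ s, f i) :=
  Finset.sum_induction f IsRigidAnalytic (fun _ _ ↦ IsRigidAnalytic.add)
    (fun m ε hε ↦ ⟨0, 1, by simp, fun z _ ↦ by simpa using hε.le⟩) hf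

/-- Division by `t` shrinks the distance to `K_∞` by the factor `q`, which costs one step in the
index of the affinoid. -/
theorem div_mem_affinoid {m : ℕ} {z : CInfty F} (hz : z ∈ affinoid F m) {b : F[X]}
    (hb : ‖ofA b‖ ≤ 1) : (z + ofA b) / ofA Polynomial.X ∈ affinoid F (m + 1) := by
  have hq : (1 : ℝ) < Fintype.card F := by exact_mod_cast Fintype.one_lt_card
  have hqm : 1 ≤ (Fintype.card F : ℝ) ^ m := one_le_pow₀ hq.le
  refine ⟨?_, fun x ↦ ?_⟩
  · rw [norm_div, norm_ofA_X, div_le_iff₀ (by positivity)]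
    have h1 : (Fintype.card F : ℝ) ^ m ≤ (Fintype.card F : ℝ) ^ (m + 1) * Fintype.card F := by
      rw [pow_succ, mul_assoc]
      exact le_mul_of_one_le_right (by positivity) (one_le_mul_of_one_le_of_one_le hq.le hq.le)
    exact (IsUltrametricDist.norm_add_le_max _ _).trans
      (max_le (hz.1.trans h1) (hb.trans (hqm.trans h1)))
  · set y : KInfty F := algebraMap (RatFunc F) (KInfty F) (algebraMap F[X] (RatFunc F) Polynomial.X) * x -
      algebraMap (RatFunc F) (KInfty F) (algebraMap F[X] (RatFunc F) b)
    have h := hz.2 y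
    have hy : ofKInfty y = ofA Polynomial.X * ofKInfty x - ofA b := by
      rw [map_sub, map_mul]; rfl
    have h2 : (z + ofA b) / ofA Polynomial.X - ofKInfty x = (z - ofKInfty y) / ofA Polynomial.X := by
      rw [hy]
      have := ofA_X_ne_zero (F := F)
      field_simp
      ring
    rw [h2, norm_div, norm_ofA_X, pow_succ, mul_inv, ← div_eq_mul_inv]
    gcongr

theorem norm_ofA_C_le (β : F) : ‖ofA (Polynomial.C β)‖ ≤ 1 := by
  by_cases h : β = 0
  · simp [h]
  · rw [norm_ofA (by simpa), Polynomial.natDegree_C, pow_zero]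

theorem IsRigidAnalytic.slash_shiftGL {f : Omega F → CInfty F} (hf : IsRigidAnalytic f) (k : ℤ)
    (β : F) : IsRigidAnalytic (slash k (shiftGL (Polynomial.C β)) f) := fun m ε hε ↦ by
  obtain ⟨P, Q, hQ, hP⟩ := hf (m + 1) ε hε
  set T := ofA (Polynomial.X : F[X])
  set L : (CInfty F)[X] := Polynomial.C T⁻¹ * (Polynomial.X + Polynomial.C (ofA (Polynomial.C β)))
  have hL (z : CInfty F) : L.eval z = (z + ofA (Polynomial.C β)) / T := by
    simp [L, div_eq_inv_mul]
  refine ⟨Polynomial.C T⁻¹ * P.comp L, Q.comp L, fun z hz ↦ ?_, fun z hz ↦ ?_⟩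
  · rw [Polynomial.eval_comp, hL]
    exact hQ _ (div_mem_affinoid hz (norm_ofA_C_le β))
  · have hz' := div_mem_affinoid hz (norm_ofA_C_le β)
    rw [← moebius_shiftGL] at hz'
    have h1 := hP _ hz'
    rw [Drinfeld.slash_shiftGL, Polynomial.eval_mul, Polynomial.eval_C, Polynomial.eval_comp,
      Polynomial.eval_comp, hL, ← moebius_shiftGL, mul_div_assoc, ← mul_sub, norm_mul, norm_inv,
      norm_ofA_X]
    have hq : (1 : ℝ) ≤ Fintype.card F := by exact_mod_cast Fintype.card_pos
    exact (mul_le_of_le_one_left (norm_nonneg _) (inv_le_one_of_one_le₀ hq)).trans h1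

theorem IsRigidAnalytic.shiftSum {f : Omega F → CInfty F} (hf : IsRigidAnalytic f) (k : ℤ) :
    IsRigidAnalytic (shiftSum k f) := by
  rw [shiftSum_apply]
  exact IsRigidAnalytic.sum _ fun β _ ↦ hf.slash_shiftGL k β

/-! ### Widths and uniformizers -/

/-- The values of `π e_A`. -/
def carlitzExp (π z : CInfty F) : CInfty F := π * expo ⊤ z

theorem carlitzExp_add (π z w : CInfty F) :
    carlitzExp π (z + w) = carlitzExp π z + carlitzExp π w := by
  rw [carlitzExp, expo_top_add, mul_add]; rfl

theorem carlitzExp_ofA (π : CInfty F) (a : F[X]) : carlitzExp π (ofA a) = 0 := by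
  rw [carlitzExp, expo_ofA (AddSubgroup.mem_top a), mul_zero]

theorem carlitzExp_ne_zero {π : CInfty F} (hπ : π ≠ 0) {z : CInfty F} (hz : ∀ a, z ≠ ofA a) :
    carlitzExp π z ≠ 0 :=
  mul_ne_zero hπ (expo_ne_zero ⊤ fun b _ ↦ hz b)

theorem carlitzExp_X_mul {π : CInfty F} (hπ : IsCarlitzPeriod π) (z : CInfty F) :
    carlitzExp π (ofA Polynomial.X * z) =
      ofA Polynomial.X * carlitzExp π z + carlitzExp π z ^ Fintype.card F := (hπ.2 z).symm

theorem unif_tpow (π : CInfty F) (m : ℕ) (z : CInfty F) : unif π (tpow F m) z =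
    (ofA Polynomial.X ^ m * carlitzExp π (z / ofA Polynomial.X ^ m))⁻¹ := by
  rw [unif, expo_tpow, carlitzExp, one_div, mul_left_comm]

theorem div_ne_ofA (z : Omega F) (m : ℕ) (a : F[X]) :
    (z : CInfty F) / ofA Polynomial.X ^ m ≠ ofA a := by
  rw [Ne, div_eq_iff (pow_ne_zero _ ofA_X_ne_zero), ← map_pow, ← map_mul]
  intro h
  exact z.2 ⟨_, h.symm⟩

theorem carlitzExp_div_ne_zero {π : CInfty F} (hπ : π ≠ 0) (z : Omega F) (m : ℕ) :
    carlitzExp π ((z : CInfty F) / ofA Polynomial.X ^ m) ≠ 0 :=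
  carlitzExp_ne_zero hπ (div_ne_ofA z m)

theorem unif_tpow_ne_zero {π : CInfty F} (hπ : π ≠ 0) (z : Omega F) (m : ℕ) :
    unif π (tpow F m) (z : CInfty F) ≠ 0 := by
  rw [unif_tpow]
  exact inv_ne_zero (mul_ne_zero (pow_ne_zero _ ofA_X_ne_zero) (carlitzExp_div_ne_zero hπ z m))

theorem mem_width_iff {𝔫 : F[X]} {ν : SL(2, F[X])} {b : F[X]} :
    b ∈ width 𝔫 ν ↔ 𝔫 ∣ b * ν 0 0 * ν 1 0 ∧ 𝔫 ∣ b * ν 1 0 ^ 2 := by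
  change ν * transl b * ν⁻¹ ∈ Gamma1 𝔫 ↔ _
  change (_ ∣ _ ∧ _ ∣ _ ∧ _ ∣ _) ↔ _
  obtain ⟨i00, i01, i10, i11⟩ := sl2_inv_apply ν
  obtain ⟨t00, t01, t10, t11⟩ := transl_apply b
  simp only [sl2_mul_apply, i00, i01, i10, i11, t00, t01, t10, t11]
  have hdet := sl2_det ν
  have e1 : (ν 0 0 * 1 + ν 0 1 * 0) * ν 1 1 + (ν 0 0 * b + ν 0 1 * 1) * -ν 1 0 - 1 =
      -(b * ν 0 0 * ν 1 0) := by linear_combination hdet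
  have e2 : (ν 1 0 * 1 + ν 1 1 * 0) * ν 1 1 + (ν 1 0 * b + ν 1 1 * 1) * -ν 1 0 =
      -(b * ν 1 0 ^ 2) := by ring
  have e3 : (ν 1 0 * 1 + ν 1 1 * 0) * -ν 0 1 + (ν 1 0 * b + ν 1 1 * 1) * ν 0 0 - 1 =
      b * ν 0 0 * ν 1 0 := by linear_combination hdet
  rw [e1, e2, e3, dvd_neg, dvd_neg]
  tauto

/-- With `(a, c)` the first column of `ν`, the conditions are `t^n ∣ b a c` and `t^n ∣ b c²`. If `0
< v < n` then `a` is prime to `t` and the first one forces `t^(n-v) ∣ b`; if `v = 0 < n` then `c` is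
prime to `t` and the second one does. -/
theorem width_eq {n v : ℕ} {ν : SL(2, F[X])} (hv : v ≤ n) (h : Polynomial.X ^ v ∣ ν 1 0)
    (h' : v < n → ¬ Polynomial.X ^ (v + 1) ∣ ν 1 0) :
    width (Polynomial.X ^ n) ν = tpow F (n - v) := by
  ext b
  rw [mem_width_iff, mem_tpow]
  have hpr : Prime (Polynomial.X : F[X]) := Polynomial.prime_X
  constructor
  · rintro ⟨h1, h2⟩
    rcases hv.eq_or_lt with rfl | hvn
    · simp
    obtain ⟨w, hw⟩ := h
    have hXw : ¬ Polynomial.X ∣ w := fun ⟨u, hu⟩ ↦ h' hvn ⟨u, by rw [hw, hu]; ring⟩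
    by_cases h0 : v = 0
    · subst h0
      rw [pow_zero, one_mul] at hw
      rw [hw] at h2
      exact hpr.pow_dvd_of_dvd_mul_right _ (fun hd ↦ hXw (hpr.dvd_of_dvd_pow hd)) h2
    · have hx : ¬ Polynomial.X ∣ ν 0 0 := fun hd ↦ by
        have h3 : Polynomial.X ∣ ν 1 0 := hw ▸ (dvd_pow_self _ h0).mul_right _
        have := sl2_det ν
        exact hpr.not_dvd_one (this ▸ dvd_sub (hd.mul_right _) (h3.mul_left _))
      rw [hw, show b * ν 0 0 * (Polynomial.X ^ v * w) = (b * Polynomial.X ^ v) * (ν 0 0 * w) by ring]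
        at h1
      have h4 := hpr.pow_dvd_of_dvd_mul_right n (fun hd ↦ (hpr.dvd_or_dvd hd).elim hx hXw) h1
      rw [← Nat.sub_add_cancel hv, pow_add] at h4
      exact (mul_dvd_mul_iff_right (pow_ne_zero _ hpr.ne_zero)).1 h4
  · intro hb
    have h3 : (Polynomial.X : F[X]) ^ n ∣ b * ν 1 0 := by
      have := mul_dvd_mul hb h
      rwa [← pow_add, Nat.sub_add_cancel hv] at this
    exact ⟨by rw [mul_right_comm]; exact h3.mul_right _, by rw [pow_two, ← mul_assoc]; exact h3.mul_right _⟩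

end Drinfeld

open Filter Topology

/-! ### Newton's identities for `Y^(r+1) + T Y = w`. -/

section PowerSums

/-- The polynomials in `u` expressing the power sums of the inverses of the roots of
`Y^(r+1) + T Y = u⁻¹`. -/
def powerSumPoly {K : Type*} [CommRing K] (T : K) (r : ℕ) : ℕ → K[X]
  | 0 => 0
  | n + 1 => Polynomial.X * ((if n = 0 then Polynomial.C T else 0) +
      Polynomial.C T * powerSumPoly T r n + if r + 1 ≤ n then powerSumPoly T r (n - r) else 0)

theorem powerSumPoly_coeff_zero {K : Type*} [CommRing K] (T : K) (r n : ℕ) :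
    (powerSumPoly T r n).coeff 0 = 0 := by
  cases n <;> simp [powerSumPoly]

/-- From index `2` on, the recursion is `u` times a combination of earlier polynomials, none of
which has a constant term. This is why `U_t` preserves double vanishing at the cusps with `v = n`.
-/
theorem powerSumPoly_coeff_one {K : Type*} [CommRing K] (T : K) (r : ℕ) {n : ℕ} (hn : 2 ≤ n) :
    (powerSumPoly T r n).coeff 1 = 0 := by
  obtain ⟨n, rfl⟩ := Nat.exists_eq_add_of_le' hn
  rw [show n + 2 = (n + 1) + 1 from rfl, powerSumPoly, Polynomial.coeff_X_mul]
  split_ifs <;> simp_all [Polynomial.mul_coeff_zero, powerSumPoly_coeff_zero]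

/-- Each step of the recursion gains a factor `u` and lowers the index by at most `r + 1`. The
linear growth of the order makes the coefficients of the summed series finite sums. -/
theorem powerSumPoly_coeff_eq_zero {K : Type*} [CommRing K] (T : K) (r : ℕ) (n : ℕ) :
    ∀ i, (r + 1) * i < n → (powerSumPoly T r n).coeff i = 0 := by
  induction n using Nat.strong_induction_on with
  | _ n ih =>
    intro i hi
    obtain ⟨n, rfl⟩ := Nat.exists_eq_add_one_of_ne_zero (Nat.ne_zero_of_lt hi)
    cases i with
    | zero => exact powerSumPoly_coeff_zero ..
    | succ i =>
      rw [mul_add, mul_one] at hi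
      have h1 := ih n (by omega) i (by omega)
      have h2 (h : r + 1 ≤ n) := ih (n - r) (by omega) i (by omega)
      rw [powerSumPoly, Polynomial.coeff_X_mul]
      rw [if_neg (by omega)]
      split_ifs with h
      · simp [h1, h2 h]
      · simp [h1]

theorem norm_powerSumPoly_coeff_le {K : Type*} [NormedField K] [IsUltrametricDist K] {T : K}
    (hT : 1 ≤ ‖T‖) (r : ℕ) (n : ℕ) : ∀ i, ‖(powerSumPoly T r n).coeff i‖ ≤ ‖T‖ ^ n := by
  induction n using Nat.strong_induction_on with
  | _ n ih =>
    intro i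
    cases n with
    | zero => simp [powerSumPoly]
    | succ n =>
      cases i with
      | zero => rw [powerSumPoly_coeff_zero, norm_zero]; positivity
      | succ i =>
        rw [powerSumPoly, Polynomial.coeff_X_mul, Polynomial.coeff_add, Polynomial.coeff_add,
          Polynomial.coeff_C_mul]
        refine (IsUltrametricDist.norm_add_le_max _ _).trans (max_le
          ((IsUltrametricDist.norm_add_le_max _ _).trans (max_le ?_ ?_)) ?_)
        · split_ifs
          · rw [Polynomial.coeff_C]
            split_ifs
            · exact le_self_pow₀ hT (by omega)
            · rw [norm_zero]; positivity
          · rw [Polynomial.coeff_zero, norm_zero]; positivity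
        · rw [norm_mul, pow_succ']
          exact mul_le_mul_of_nonneg_left (ih n (by omega) i) (norm_nonneg _)
        · split_ifs
          · exact (ih (n - r) (by omega) i).trans (pow_le_pow_right₀ hT (by omega))
          · rw [Polynomial.coeff_zero, norm_zero]; positivity

variable {K ι : Type*} [Field K] [Fintype ι]

open Polynomial in
-- The product over the distinct roots divides the right side, and both are monic of degree `r + 1`.
theorem prod_X_sub_C_eq_of_roots {r : ℕ} (hr : r ≠ 0) {T w : K} {x : ι → K}
    (hx : Function.Injective x) (hcard : Fintype.card ι = r + 1)
    (hroot : ∀ i, T * x i + x i ^ (r + 1) = w) :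
    ∏ i, (X - C (x i)) = X ^ (r + 1) + C T * X - C w := by
  have hmon : (∏ i, (X - C (x i))).Monic := monic_prod_of_monic _ _ fun i _ ↦ monic_X_sub_C _
  have hdeg1 : (C T * X - C w).degree < ((r + 1 : ℕ) : WithBot ℕ) := by
    refine (degree_sub_le _ _).trans_lt (max_lt ((degree_C_mul_X_le T).trans_lt ?_)
      (degree_C_le.trans_lt ?_)) <;> norm_cast <;> omega
  have hmon' : (X ^ (r + 1) + (C T * X - C w)).Monic := monic_X_pow_add hdeg1
  have hdeg' : (X ^ (r + 1) + (C T * X - C w)).natDegree = r + 1 :=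
    (natDegree_add_eq_left_of_degree_lt (by rwa [degree_X_pow])).trans (natDegree_X_pow _)
  rw [add_sub_assoc]
  refine (eq_of_monic_of_dvd_of_natDegree_le hmon hmon' ?_ ?_).symm
  · refine Finset.prod_dvd_of_coprime (fun i _ j _ hij ↦ ?_) fun i _ ↦ ?_
    · exact pairwise_coprime_X_sub_C hx hij
    · rw [dvd_iff_isRoot, IsRoot]
      simp only [eval_add, eval_sub, eval_mul, eval_C, eval_X, eval_pow]
      linear_combination hroot i
  · rw [hdeg', natDegree_prod_of_monic _ _ fun i _ ↦ monic_X_sub_C _]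
    simp [hcard]

/-- Newton's identities for the inverses of the roots of `Y^(r+1) + T Y - w`. -/
theorem sum_inv_pow_eq_powerSumPoly {r : ℕ} (hr : r ≠ 0) {T w : K} (hw : w ≠ 0) {x : ι → K}
    (hx : Function.Injective x) (hcard : Fintype.card ι = r + 1) (hchar : ((r + 1 : ℕ) : K) = 0)
    (hroot : ∀ i, T * x i + x i ^ (r + 1) = w) (n : ℕ) :
    ∑ i, (x i)⁻¹ ^ n = (powerSumPoly T r n).eval w⁻¹ := by
  classical
  have hx0 (i) : x i ≠ 0 := fun h ↦ hw (by rw [← hroot i, h]; simp)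
  have hprod := prod_X_sub_C_eq_of_roots hr hx hcard hroot
  -- `S` expands the sum of the `-1/(Y - x i)`, that is, minus the logarithmic derivative of `∏ (Y -
  -- x i)`. Comparing coefficients in `key` gives the recursion.
  set S : PowerSeries K := PowerSeries.mk fun n ↦ ∑ i, (x i)⁻¹ ^ (n + 1)
  have hS (n) : PowerSeries.coeff n S = ∑ i, (x i)⁻¹ ^ (n + 1) := PowerSeries.coeff_mk _ _
  clear_value S
  have hgeom (i) : (PowerSeries.X - PowerSeries.C (x i)) *
      PowerSeries.mk (fun n ↦ (x i)⁻¹ ^ (n + 1)) = -1 := by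
    ext m
    rw [sub_mul, map_sub, PowerSeries.coeff_C_mul, PowerSeries.coeff_mk]
    cases m with
    | zero => simp [hx0 i]
    | succ m =>
      rw [PowerSeries.coeff_succ_X_mul, PowerSeries.coeff_mk, pow_succ _ (m + 1), mul_left_comm,
        mul_inv_cancel₀ (hx0 i)]
      simp [PowerSeries.coeff_one]
  -- Since `r + 1 = 0` in `K`, the derivative of `Y^(r+1) + T Y - w` is the constant `T`.
  have hder : ∑ i, ∏ j ∈ Finset.univ.erase i, (Polynomial.X - Polynomial.C (x j)) =
      Polynomial.C T := by
    have h := congr_arg Polynomial.derivative hprod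
    rw [Polynomial.derivative_prod_finset] at h
    have hchar' : (r : K) + 1 = 0 := by exact_mod_cast hchar
    simpa [hchar', ← map_natCast (Polynomial.C : K →+* K[X])] using h
  have key : (PowerSeries.X ^ (r + 1) + PowerSeries.C T * PowerSeries.X - PowerSeries.C w) * S =
      -PowerSeries.C T := by
    have h1 : (PowerSeries.X ^ (r + 1) + PowerSeries.C T * PowerSeries.X - PowerSeries.C w) =
        ∏ i, (PowerSeries.X - PowerSeries.C (x i)) := by
      have := congr_arg (Polynomial.coeToPowerSeries.ringHom (R := K)) hprod
      simpa [map_prod] using this.symm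
    have h2 : S = ∑ i, PowerSeries.mk (fun n ↦ (x i)⁻¹ ^ (n + 1)) := by
      ext m; simp [hS]
    have h3 := congr_arg (Polynomial.coeToPowerSeries.ringHom (R := K)) hder
    rw [map_sum] at h3
    simp only [map_prod, map_sub, Polynomial.coeToPowerSeries.ringHom_apply, Polynomial.coe_X,
      Polynomial.coe_C] at h3
    rw [h1, h2, Finset.mul_sum, ← h3, ← Finset.sum_neg_distrib]
    refine Finset.sum_congr rfl fun i hi ↦ ?_
    rw [← Finset.mul_prod_erase _ _ hi, mul_right_comm, hgeom, neg_one_mul]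
  have hrec (n : ℕ) : ∑ i, (x i)⁻¹ ^ (n + 1) = w⁻¹ * ((if n = 0 then T else 0) +
      T * (if n = 0 then 0 else ∑ i, (x i)⁻¹ ^ n) +
      if r + 1 ≤ n then ∑ i, (x i)⁻¹ ^ (n - r) else 0) := by
    have h := congr_arg (PowerSeries.coeff n) key
    rw [sub_mul, add_mul, mul_assoc, map_sub, map_add, PowerSeries.coeff_C_mul,
      PowerSeries.coeff_C_mul, PowerSeries.coeff_X_pow_mul', map_neg, PowerSeries.coeff_C,
      hS n] at h
    rw [eq_inv_mul_iff_mul_eq₀ hw]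
    cases n with
    | zero =>
      simp at h ⊢
      exact h
    | succ n =>
      rw [PowerSeries.coeff_succ_X_mul, hS n, if_neg (Nat.succ_ne_zero n)] at h
      rw [if_neg (Nat.succ_ne_zero n), if_neg (Nat.succ_ne_zero n)]
      split_ifs at h ⊢ with h5
      · rw [hS, show n + 1 - (r + 1) + 1 = n + 1 - r by omega] at h
        linear_combination -h
      · linear_combination -h
  induction n using Nat.strong_induction_on with
  | _ n ih =>
    cases n with
    | zero =>
      -- The zeroth power sum counts the `r + 1` roots, and this number is `0` in `K`.
      simp only [pow_zero, Finset.sum_const, Finset.card_univ, hcard, powerSumPoly,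
        Polynomial.eval_zero]
      rw [nsmul_eq_mul, hchar, zero_mul]
    | succ n =>
      rw [hrec, powerSumPoly, Polynomial.eval_mul, Polynomial.eval_X, Polynomial.eval_add,
        Polynomial.eval_add, Polynomial.eval_mul, Polynomial.eval_C]
      congr 2
      · congr 1
        · split_ifs <;> simp
        · congr 1
          split_ifs with h
          · simp [h, powerSumPoly]
          · exact ih n (by omega)
      · split_ifs
        · exact ih (n - r) (by omega)
        · simp

end PowerSums

/-! ### Interchanging the order of summation. -/

section Rearrangement

variable {K : Type*} [NormedField K] [CompleteSpace K]

/-- Substituting polynomials whose orders tend linearly to infinity into a power series. -/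
theorem exists_hasSum_of_hasSum_polynomial {a : ℕ → K} {P : ℕ → K[X]} {C R M : ℝ} {q : ℕ}
    (hq : q ≠ 0) (hR : 1 ≤ R) (hM : 1 ≤ M) (ha : ∀ n, ‖a n‖ ≤ C * R ^ n)
    (hP : ∀ n i, ‖(P n).coeff i‖ ≤ M ^ n) (hP0 : ∀ n i, q * i < n → (P n).coeff i = 0) :
    ∃ δ > 0, ∀ u : K, ‖u‖ < δ → ∀ s, HasSum (fun n ↦ a n * (P n).eval u) s →
      HasSum (fun i ↦ (∑ n ∈ Finset.range (q * i + 1), a n * (P n).coeff i) * u ^ i) s := by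
  have hC : 0 ≤ C := by simpa using (norm_nonneg _).trans (ha 0)
  -- The radius will be `t^(2q)`. For nonzero terms `n ≤ q i`, so one half of the exponent gives
  -- `t^n`, which offsets `(R M)^n` and leaves `(1/2)^n`; the other half gives `(1/2)^i`. The double
  -- series is then absolutely summable.
  set t : ℝ := (2 * (R * M))⁻¹
  have hRM : 1 ≤ R * M := one_le_mul_of_one_le_of_one_le hR hM
  have ht0 : 0 < t := by positivity
  have ht : t ≤ 1 / 2 := by
    rw [one_div]; exact inv_anti₀ two_pos (by linarith)
  refine ⟨t ^ (2 * q), by positivity, fun u hu s hs ↦ ?_⟩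
  set f : ℕ × ℕ → K := fun p ↦ a p.1 * (P p.1).coeff p.2 * u ^ p.2
  have hbound (p : ℕ × ℕ) : ‖f p‖ ≤ C * ((1 / 2) ^ p.1 * (1 / 2) ^ p.2) := by
    obtain ⟨n, i⟩ := p
    by_cases h : q * i < n
    · simp only [f, hP0 n i h, mul_zero, zero_mul, norm_zero]
      positivity
    · have hu' : ‖u‖ ^ i ≤ t ^ n * (1 / 2) ^ i := by
        calc ‖u‖ ^ i ≤ (t ^ (2 * q)) ^ i := pow_le_pow_left₀ (norm_nonneg _) hu.le i
          _ = t ^ (q * i) * t ^ (q * i) := by rw [← pow_mul, ← pow_add]; congr 1; ring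
          _ ≤ t ^ n * t ^ i := by
              have ht1 : t ≤ 1 := by linarith
              refine mul_le_mul (pow_le_pow_of_le_one ht0.le ht1 (not_lt.1 h))
                (pow_le_pow_of_le_one ht0.le ht1 (Nat.le_mul_of_pos_left i (Nat.pos_of_ne_zero hq)))
                (by positivity) (by positivity)
          _ ≤ t ^ n * (1 / 2) ^ i := by gcongr
      have hRMt : R * M * t = 1 / 2 := by
        simp only [t]; field_simp
      calc ‖f (n, i)‖ = ‖a n‖ * ‖(P n).coeff i‖ * ‖u‖ ^ i := by
            simp only [f, norm_mul, norm_pow]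
        _ ≤ (C * R ^ n) * M ^ n * (t ^ n * (1 / 2) ^ i) := by
            gcongr
            · exact ha n
            · exact hP n i
        _ = C * ((R * M * t) ^ n * (1 / 2) ^ i) := by ring
        _ = _ := by rw [hRMt]
  have hsum : Summable f := by
    refine Summable.of_norm_bounded (g := fun p : ℕ × ℕ ↦ C * ((1 / 2) ^ p.1 * (1 / 2) ^ p.2))
      (Summable.mul_left C ?_) hbound
    exact summable_geometric_two.mul_of_nonneg summable_geometric_two
      (fun _ ↦ by positivity) (fun _ ↦ by positivity)
  have h1 (n : ℕ) : HasSum (fun i ↦ f (n, i)) (a n * (P n).eval u) := by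
    rw [Polynomial.eval_eq_sum_range, Finset.mul_sum]
    simp only [f, mul_assoc]
    refine hasSum_sum_of_ne_finset_zero fun i hi ↦ ?_
    rw [Polynomial.coeff_eq_zero_of_natDegree_lt (by simpa using hi)]
    simp
  have h2 (i : ℕ) : HasSum (fun n ↦ f (n, i))
      ((∑ n ∈ Finset.range (q * i + 1), a n * (P n).coeff i) * u ^ i) := by
    rw [Finset.sum_mul]
    refine hasSum_sum_of_ne_finset_zero fun n hn ↦ ?_
    simp only [f]
    rw [hP0 n i (by rw [Finset.mem_range] at hn; omega)]
    simp
  have h3 := hsum.hasSum.prod_fiberwise h1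
  rw [hs.unique h3]
  have h4 : HasSum (f ∘ Prod.swap) (∑' p, f p) := (Equiv.prodComm ℕ ℕ).hasSum_iff.2 hsum.hasSum
  exact h4.prod_fiberwise h2

end Rearrangement

/-! ### Expansions in the uniformizer and their behaviour under pullback. -/

namespace Drinfeld

open Filter Topology

variable {F : Type*} [Field F] [Fintype F]

/-- Near the cusp `∞`, `g` is a power series of order at least `j` in the uniformizer attached to
`(t^m)`. -/
def HasSeries (π : CInfty F) (m j : ℕ) (g : Omega F → CInfty F) : Prop :=
  ∃ a : PowerSeries (CInfty F), (∃ ε > 0, ∀ z : Omega F, ‖unif π (tpow F m) (z : CInfty F)‖ < ε →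
    HasSum (fun i ↦ PowerSeries.coeff i a * unif π (tpow F m) (z : CInfty F) ^ i) (g z)) ∧
    (j : ℕ∞) ≤ a.order

/-- Near the cusp `∞`, `g` is an analytic function of order at least `j` of the uniformizer
attached to `(t^m)`. -/
def HasExpansion (π : CInfty F) (m j : ℕ) (g : Omega F → CInfty F) : Prop :=
  ∃ H : CInfty F → CInfty F, AnalyticAt (CInfty F) H 0 ∧ ∃ ε > 0, ∀ z : Omega F,
    ‖unif π (tpow F m) (z : CInfty F)‖ < ε →
      g z = unif π (tpow F m) (z : CInfty F) ^ j * H (unif π (tpow F m) (z : CInfty F))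

theorem exists_fourierExpansion_iff {π : CInfty F} {𝔫 : F[X]} {k : ℤ} {ν : SL(2, F[X])}
    {f : Omega F → CInfty F} {m j : ℕ} (h : width 𝔫 ν = tpow F m) :
    (∃ a, IsFourierExpansion π 𝔫 k ν f a ∧ (j : ℕ∞) ≤ a.order) ↔
      HasSeries π m j (slash k (slToGL ν) f) := by
  simp only [IsFourierExpansion, h]
  rfl

theorem natCast_le_order_iff {R : Type*} [CommRing R] {a : PowerSeries R} {j : ℕ} :
    (j : ℕ∞) ≤ a.order ↔ PowerSeries.X ^ j ∣ a := by
  rw [PowerSeries.X_pow_dvd_iff]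
  exact ⟨fun h m hm ↦ PowerSeries.coeff_of_lt_order m ((Nat.cast_lt.2 hm).trans_le h),
    PowerSeries.nat_le_order a j⟩

theorem hasSum_mul_pow_iff {K : Type*} [NormedField K] (a : PowerSeries K) (j : ℕ) (u s : K) :
    HasSum (fun i ↦ PowerSeries.coeff i (PowerSeries.X ^ j * a) * u ^ i) (u ^ j * s) ↔
      HasSum (fun i ↦ PowerSeries.coeff i a * u ^ i * u ^ j) (s * u ^ j) := by
  rw [← hasSum_nat_add_iff' j, Finset.sum_eq_zero, sub_zero, mul_comm s]
  · simp only [PowerSeries.coeff_X_pow_mul', le_add_iff_nonneg_left, zero_le, if_true,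
      Nat.add_sub_cancel, pow_add, mul_assoc]
  · intro i hi
    rw [PowerSeries.coeff_X_pow_mul', if_neg (by simpa using hi), zero_mul]

theorem HasExpansion.hasSeries {π : CInfty F} {m j : ℕ} {g : Omega F → CInfty F}
    (hg : HasExpansion π m j g) : HasSeries π m j g := by
  obtain ⟨H, ⟨p, hp⟩, ε, hε, h⟩ := hg
  rw [hasFPowerSeriesAt_iff] at hp
  obtain ⟨δ, hδ, hp⟩ := Metric.eventually_nhds_iff.1 hp
  refine ⟨PowerSeries.X ^ j * PowerSeries.mk p.coeff, ⟨min ε δ, lt_min hε hδ, fun z hz ↦ ?_⟩, ?_⟩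
  · rw [h z (hz.trans_le (min_le_left _ _)), hasSum_mul_pow_iff]
    have := @hp (unif π (tpow F m) (z : CInfty F)) (by simpa using hz.trans_le (min_le_right _ _))
    rw [zero_add] at this
    simpa [mul_comm] using this.mul_right (unif π (tpow F m) (z : CInfty F) ^ j)
  · exact natCast_le_order_iff.2 (dvd_mul_right _ _)

/-- In the ultrametric setting terms tending to `0` suffice for summability, so convergence at `u₀`
spreads to the closed disc of radius `‖u₀‖`. -/
theorem analyticAt_tsum {K : Type*} [NontriviallyNormedField K] [CompleteSpace K]
    [IsUltrametricDist K] {a : ℕ → K} {u₀ : K} (hu₀ : u₀ ≠ 0)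
    (ha : Summable fun i ↦ a i * u₀ ^ i) :
    AnalyticAt K (fun u ↦ ∑' i, a i * u ^ i) 0 ∧
      ∀ u, ‖u‖ ≤ ‖u₀‖ → HasSum (fun i ↦ a i * u ^ i) (∑' i, a i * u ^ i) := by
  have h (u : K) (hu : ‖u‖ ≤ ‖u₀‖) : HasSum (fun i ↦ a i * u ^ i) (∑' i, a i * u ^ i) := by
    refine (NonarchimedeanAddGroup.summable_of_tendsto_cofinite_zero ?_).hasSum
    refine squeeze_zero_norm (fun i ↦ ?_) (tendsto_norm_zero.comp ha.tendsto_cofinite_zero)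
    simp only [Function.comp, norm_mul, norm_pow]
    gcongr
  refine ⟨⟨FormalMultilinearSeries.ofScalars K a, ?_⟩, h⟩
  rw [hasFPowerSeriesAt_iff]
  refine Metric.eventually_nhds_iff.2 ⟨‖u₀‖, norm_pos_iff.2 hu₀, fun {u} hu ↦ ?_⟩
  rw [dist_zero_right] at hu
  simpa [FormalMultilinearSeries.coeff_ofScalars, mul_comm] using h u hu.le

/-- Analytic functions can be substituted into one another without manipulating coefficients, so
pullbacks are computed with `HasExpansion`. Convergence at one point with `u ≠ 0` gives analyticity;
if no point of `Ω` meets the bound on `u`, the expansion is vacuous. -/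
theorem HasSeries.hasExpansion {π : CInfty F} (hπ : π ≠ 0) {m j : ℕ} {g : Omega F → CInfty F}
    (hg : HasSeries π m j g) : HasExpansion π m j g := by
  obtain ⟨a, ⟨ε, hε, h⟩, hj⟩ := hg
  obtain ⟨a, rfl⟩ := natCast_le_order_iff.1 hj
  by_cases hz : ∃ z : Omega F, ‖unif π (tpow F m) (z : CInfty F)‖ < ε
  · obtain ⟨z₀, hz₀⟩ := hz
    set u₀ := unif π (tpow F m) (z₀ : CInfty F)
    have hu₀ : u₀ ≠ 0 := unif_tpow_ne_zero hπ z₀ m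
    have hsum : Summable fun i ↦ PowerSeries.coeff i a * u₀ ^ i := by
      have h1 := h z₀ hz₀
      rw [show g z₀ = u₀ ^ j * (u₀⁻¹ ^ j * g z₀) by
        rw [← mul_assoc, ← mul_pow, mul_inv_cancel₀ hu₀, one_pow, one_mul], hasSum_mul_pow_iff] at h1
      exact (summable_mul_right_iff (pow_ne_zero j hu₀)).1 h1.summable
    obtain ⟨hH, hH'⟩ := analyticAt_tsum hu₀ hsum
    refine ⟨_, hH, min ε ‖u₀‖, lt_min hε (norm_pos_iff.2 hu₀), fun z hz ↦ ?_⟩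
    refine (h z (hz.trans_le (min_le_left _ _))).unique ?_
    rw [hasSum_mul_pow_iff]
    exact (hH' _ (hz.le.trans (min_le_right _ _))).mul_right _
  · exact ⟨0, analyticAt_const, ε, hε, fun z hz' ↦ absurd ⟨z, hz'⟩ hz⟩

theorem HasExpansion.mono {π : CInfty F} {m i j : ℕ} {g : Omega F → CInfty F}
    (hg : HasExpansion π m j g) (hij : i ≤ j) : HasExpansion π m i g := by
  obtain ⟨H, hH, ε, hε, h⟩ := hg
  refine ⟨fun u ↦ u ^ (j - i) * H u, by fun_prop, ε, hε, fun z hz ↦ ?_⟩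
  rw [h z hz, ← mul_assoc, ← pow_add, Nat.add_sub_cancel' hij]

theorem HasExpansion.sum {π : CInfty F} {m j : ℕ} {ι : Type*} (s : Finset ι)
    {g : ι → Omega F → CInfty F} (hg : ∀ i ∈ s, HasExpansion π m j (g i)) :
    HasExpansion π m j (∑ i ∈ s, g i) := by
  refine Finset.sum_induction g _ ?_ ⟨0, analyticAt_const, 1, one_pos, by simp⟩ hg
  rintro _ _ ⟨H, hH, ε, hε, h⟩ ⟨H', hH', ε', hε', h'⟩
  refine ⟨fun u ↦ H u + H' u, by fun_prop, min ε ε', lt_min hε hε', fun z hz ↦ ?_⟩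
  rw [Pi.add_apply, h z (hz.trans_le (min_le_left _ _)), h' z (hz.trans_le (min_le_right _ _)),
    mul_add]

/-- Pulling back expansions along a map which expresses one uniformizer by another. -/
theorem HasExpansion.comp {π : CInfty F} {m m' j e : ℕ} (he : e ≠ 0) {g g' : Omega F → CInfty F}
    (hg : HasExpansion π m' j g) (φ : Omega F → Omega F) (c : CInfty F)
    (hg' : ∀ z, g' z = c * g (φ z)) {R : CInfty F → CInfty F} (hR : AnalyticAt (CInfty F) R 0)
    (h : ∀ z : Omega F, unif π (tpow F m') (φ z : CInfty F) =
      unif π (tpow F m) (z : CInfty F) ^ e * R (unif π (tpow F m) (z : CInfty F))) :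
    HasExpansion π m (e * j) g' := by
  obtain ⟨H, hH, ε, hε, hgH⟩ := hg
  have hR' : AnalyticAt (CInfty F) (fun u ↦ u ^ e * R u) 0 := by fun_prop
  have h0 : (0 : CInfty F) ^ e * R 0 = 0 := by rw [zero_pow he, zero_mul]
  have hlim : Tendsto (fun u ↦ u ^ e * R u) (𝓝 0) (𝓝 0) := by
    simpa only [h0] using hR'.continuousAt.tendsto
  obtain ⟨δ, hδ, hlim⟩ := Metric.eventually_nhds_iff.1 (Metric.tendsto_nhds.1 hlim ε hε)
  have hcomp : AnalyticAt (CInfty F) (fun u ↦ H (u ^ e * R u)) 0 := by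
    refine AnalyticAt.fun_comp (f := fun u ↦ u ^ e * R u) ?_ hR'
    rwa [h0]
  refine ⟨fun u ↦ c * (R u ^ j * H (u ^ e * R u)),
    analyticAt_const.mul ((hR.pow j).mul hcomp), δ, hδ, fun z hz ↦ ?_⟩
  have h1 := hlim (by simpa using hz)
  rw [dist_zero_right, ← h] at h1
  rw [hg', hgH _ h1, h, mul_pow, ← pow_mul]
  ring

/-- By additivity of `e_A`, the uniformizer of `(t^m)` at `(z + b)/t` is `T u / (1 + κ T^(m+1) u)`,
with `u` the uniformizer of `(t^(m+1))` at `z`. -/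
theorem HasExpansion.slash_shiftGL {π : CInfty F} (hπ : π ≠ 0) {m j : ℕ} {g : Omega F → CInfty F}
    (hg : HasExpansion π m j g) (k : ℤ) (b : F[X]) :
    HasExpansion π (m + 1) j (slash k (shiftGL b) g) := by
  have hT := ofA_X_ne_zero (F := F)
  set T := ofA (Polynomial.X : F[X])
  set κ := carlitzExp π (ofA b / T ^ (m + 1))
  rw [← one_mul j]
  refine hg.comp one_ne_zero (moebius (shiftGL b)) T⁻¹ (fun z ↦ Drinfeld.slash_shiftGL k b g z)
    (R := fun u ↦ T / (1 + κ * T ^ (m + 1) * u)) ?_ fun z ↦ ?_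
  · fun_prop (disch := simp)
  · have hE := carlitzExp_div_ne_zero hπ z (m + 1)
    have harg : ((z : CInfty F) + ofA b) / T / T ^ m =
        (z : CInfty F) / T ^ (m + 1) + ofA b / T ^ (m + 1) := by
      rw [pow_succ]; field_simp
    rw [unif_tpow, unif_tpow, moebius_shiftGL, harg, carlitzExp_add]
    change (T ^ m * (carlitzExp π (z / T ^ (m + 1)) + κ))⁻¹ = _
    have hE' : carlitzExp π (z / T ^ (m + 1)) ≠ 0 := hE
    generalize carlitzExp π (z / T ^ (m + 1)) = E at hE'
    change _ = (T ^ (m + 1) * E)⁻¹ ^ 1 * (T / (1 + κ * T ^ (m + 1) * (T ^ (m + 1) * E)⁻¹))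
    have h1 : 1 + κ * T ^ (m + 1) * (T ^ (m + 1) * E)⁻¹ = (E + κ) / E := by
      field_simp
    rw [h1, pow_one, pow_succ]
    by_cases h2 : E + κ = 0
    · simp [h2]
    · field_simp

/-- With `E = 1/(T^m u)`, the Carlitz equation makes the uniformizer at `tz` equal to `1/(T^m (T E +
E^q))`, which is `u^q` divided by a function of `u` that is nonzero at `0`. -/
theorem HasExpansion.slash_scaleGL {π : CInfty F} (hπ : IsCarlitzPeriod π) {m j : ℕ}
    {g : Omega F → CInfty F} (hg : HasExpansion π m j g) (k : ℤ) :
    HasExpansion π m (Fintype.card F * j) (slash k (scaleGL F) g) := by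
  have hT := ofA_X_ne_zero (F := F)
  set T := ofA (Polynomial.X : F[X])
  set q := Fintype.card F
  have hq : 1 < q := Fintype.one_lt_card
  refine hg.comp (by omega) (moebius (scaleGL F)) (T ^ (k - 1))
    (fun z ↦ Drinfeld.slash_scaleGL k g z)
    (R := fun u ↦ (T * u ^ (q - 1) + T ^ m * (T⁻¹ ^ m) ^ q)⁻¹) ?_ fun z ↦ ?_
  · fun_prop (disch := simp [zero_pow (show q - 1 ≠ 0 by omega), hT])
  · have hE : carlitzExp π (z / T ^ m) ≠ 0 := carlitzExp_div_ne_zero hπ.1 z m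
    have harg : T * (z : CInfty F) / T ^ m = T * (z / T ^ m) := mul_div_assoc _ _ _
    rw [unif_tpow, unif_tpow, moebius_scaleGL, harg, carlitzExp_X_mul hπ]
    change (T ^ m * (T * carlitzExp π (z / T ^ m) + carlitzExp π (z / T ^ m) ^ q))⁻¹ =
      (T ^ m * carlitzExp π (z / T ^ m))⁻¹ ^ q * (T * (T ^ m * carlitzExp π (z / T ^ m))⁻¹ ^ (q - 1) +
        T ^ m * (T⁻¹ ^ m) ^ q)⁻¹
    generalize carlitzExp π (z / T ^ m) = E at hE
    obtain ⟨r, hr⟩ := Nat.exists_eq_add_of_lt hq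
    rw [hr, show 1 + r + 1 - 1 = r + 1 by omega, show 1 + r + 1 = r + 1 + 1 by omega, inv_pow (T ^ m * E),
      ← mul_inv]
    congr 1
    have hTm : T ^ m ≠ 0 := pow_ne_zero _ hT
    rw [inv_pow T m]
    generalize T ^ m = S at hTm
    rw [inv_pow, inv_pow]
    field_simp
    ring

/-! ### `t`-division points and the sum over `β` for the lattice `A`. -/

theorem unif_tpow_zero (π z : CInfty F) : unif π (tpow F 0) z = (carlitzExp π z)⁻¹ := by
  rw [unif_tpow, pow_zero, one_mul, div_one]

theorem ofA_C_div_X_ne {β : F} (hβ : β ≠ 0) (a : F[X]) :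
    ofA (Polynomial.C β) / ofA Polynomial.X ≠ ofA a := by
  rw [Ne, div_eq_iff ofA_X_ne_zero, ← map_mul, ofA_injective.eq_iff]
  intro h
  exact hβ (by simpa using congr_arg (fun p : F[X] ↦ p.coeff 0) h)

/-- The `t`-division points of the Carlitz module over `π e_A(z)`. -/
theorem carlitzExp_shift {π : CInfty F} (hπ : IsCarlitzPeriod π) (z : CInfty F) (β : F) :
    ofA Polynomial.X * carlitzExp π ((z + ofA (Polynomial.C β)) / ofA Polynomial.X) +
      carlitzExp π ((z + ofA (Polynomial.C β)) / ofA Polynomial.X) ^ Fintype.card F =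
      carlitzExp π z := by
  rw [← carlitzExp_X_mul hπ, mul_div_cancel₀ _ ofA_X_ne_zero, carlitzExp_add, carlitzExp_ofA,
    add_zero]

theorem carlitzExp_shift_injective {π : CInfty F} (hπ : π ≠ 0) (z : CInfty F) :
    Function.Injective fun β : F ↦
      carlitzExp π ((z + ofA (Polynomial.C β)) / ofA Polynomial.X) := by
  intro β β' h
  by_contra hne
  refine carlitzExp_ne_zero hπ (ofA_C_div_X_ne (sub_ne_zero.2 hne)) ?_
  have h1 : (z + ofA (Polynomial.C β)) / ofA Polynomial.X =
      (z + ofA (Polynomial.C β')) / ofA Polynomial.X +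
        ofA (Polynomial.C (β - β')) / ofA Polynomial.X := by
    rw [map_sub, map_sub]; ring
  have h2 := h
  simp only [h1, carlitzExp_add, add_eq_left] at h2
  exact h2

theorem natCast_card_eq_zero : ((Fintype.card F : ℕ) : CInfty F) = 0 := by
  have h : ((Fintype.card F : ℕ) : CInfty F) = ofA (Polynomial.C ((Fintype.card F : ℕ) : F)) := by
    rw [map_natCast, map_natCast]
  rw [h, FiniteField.cast_card_eq_zero, map_zero, map_zero]

/-- A division point `x` satisfies `T x + x^q = 1/u(z)`, so if `‖x‖ ≤ 1/ε` then `1/u(z)` is bounded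
by `q/ε + ε^(-q)`. -/
theorem exists_norm_unif_shift_lt {π : CInfty F} (hπ : IsCarlitzPeriod π) {ε : ℝ} (hε : 0 < ε) :
    ∃ δ > 0, ∀ z : Omega F, ‖unif π (tpow F 0) (z : CInfty F)‖ < δ → ∀ β : F,
      ‖unif π (tpow F 0) (moebius (shiftGL (Polynomial.C β)) z : CInfty F)‖ < ε := by
  set q := Fintype.card F
  set B : ℝ := q * ε⁻¹ + ε⁻¹ ^ q
  have hB : 0 < B := by positivity
  refine ⟨B⁻¹, by positivity, fun z hz β ↦ ?_⟩
  have hE : carlitzExp π z ≠ 0 := by simpa using carlitzExp_div_ne_zero hπ.1 z 0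
  rw [unif_tpow_zero, norm_inv] at hz ⊢
  rw [inv_lt_inv₀ (norm_pos_iff.2 hE) hB] at hz
  by_contra! hcon
  have hroot := carlitzExp_shift hπ z β
  rw [← moebius_shiftGL] at hroot
  set x := carlitzExp π (moebius (shiftGL (Polynomial.C β)) z : CInfty F)
  have hx : ‖x‖ ≤ ε⁻¹ := by
    have := inv_anti₀ hε hcon
    rwa [inv_inv] at this
  refine absurd hz (not_lt.2 ?_)
  rw [← hroot]
  refine (norm_add_le _ _).trans (add_le_add ?_ ?_)
  · rw [norm_mul, norm_ofA_X]
    exact mul_le_mul_of_nonneg_left hx (by positivity)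
  · rw [norm_pow]
    exact pow_le_pow_left₀ (norm_nonneg _) hx _

/-- Summing the series of `g` over the `q` division points replaces `u^n` by the polynomial
`powerSumPoly`, and regrouping by powers of `u(z)` gives a power series. The bound `j ≤ 2` is what
the vanishing of the coefficients of `1` and `u` can support. -/
theorem HasSeries.shiftSum {π : CInfty F} (hπ : IsCarlitzPeriod π) {j : ℕ} (hj : j ≤ 2)
    {g : Omega F → CInfty F} (hg : HasSeries π 0 j g) (k : ℤ) :
    HasSeries π 0 j (shiftSum k g) := by
  obtain ⟨a, ⟨ε, hε, h⟩, hja⟩ := hg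
  obtain ⟨δ, hδ, hδε⟩ := exists_norm_unif_shift_lt hπ hε
  by_cases hz : ∃ z : Omega F, ‖unif π (tpow F 0) (z : CInfty F)‖ < ε
  swap
  · exact ⟨0, ⟨δ, hδ, fun z hz' ↦ absurd ⟨_, hδε z hz' 0⟩ hz⟩, by simp⟩
  obtain ⟨z₀, hz₀⟩ := hz
  obtain ⟨r, hr⟩ := Nat.exists_eq_add_of_lt (Fintype.one_lt_card (α := F))
  have hr : Fintype.card F = (r + 1) + 1 := by omega
  have hT := ofA_X_ne_zero (F := F)
  have hTnorm := norm_ofA_X (F := F)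
  set T := ofA (Polynomial.X : F[X])
  have hTnorm : 1 ≤ ‖T‖ := by
    rw [hTnorm]; exact_mod_cast Fintype.card_pos
  set c : ℕ → CInfty F := fun n ↦ T⁻¹ * PowerSeries.coeff n a
  -- Convergence at the single point `z₀` bounds the terms `a_n u₀^n`, hence the growth of the
  -- coefficients.
  obtain ⟨C, R, hR, hc⟩ : ∃ C R : ℝ, 1 ≤ R ∧ ∀ n, ‖c n‖ ≤ C * R ^ n := by
    have hu₀ := unif_tpow_ne_zero hπ.1 z₀ 0
    set u₀ := unif π (tpow F 0) (z₀ : CInfty F)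
    obtain ⟨C, hC⟩ := (h z₀ hz₀).summable.tendsto_atTop_zero.norm.bddAbove_range
    have hC0 : 0 ≤ C := (norm_nonneg _).trans (hC ⟨0, rfl⟩)
    refine ⟨C, max 1 ‖u₀‖⁻¹, le_max_left _ _, fun n ↦ ?_⟩
    have h1 : ‖PowerSeries.coeff n a‖ * ‖u₀‖ ^ n ≤ C := by
      rw [← norm_pow, ← norm_mul]; exact hC ⟨n, rfl⟩
    have h2 : 0 < ‖u₀‖ := norm_pos_iff.2 hu₀
    calc ‖c n‖ ≤ ‖PowerSeries.coeff n a‖ := by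
          rw [norm_mul, norm_inv]
          exact mul_le_of_le_one_left (norm_nonneg _) (inv_le_one_of_one_le₀ hTnorm)
      _ ≤ C * ‖u₀‖⁻¹ ^ n := by
          rw [inv_pow, ← div_eq_mul_inv, le_div_iff₀ (by positivity)]; exact h1
      _ ≤ C * max 1 ‖u₀‖⁻¹ ^ n := by
          gcongr
          exact le_max_right _ _
  obtain ⟨δ', hδ', hsum⟩ := exists_hasSum_of_hasSum_polynomial (Nat.succ_ne_zero (r + 1)) hR hTnorm
    hc (norm_powerSumPoly_coeff_le hTnorm (r + 1)) (powerSumPoly_coeff_eq_zero T (r + 1))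
  refine ⟨PowerSeries.mk fun i ↦ ∑ n ∈ Finset.range ((r + 1 + 1) * i + 1),
    c n * (powerSumPoly T (r + 1) n).coeff i, ⟨min δ δ', lt_min hδ hδ', fun z hz ↦ ?_⟩, ?_⟩
  · have hE : carlitzExp π z ≠ 0 := by simpa using carlitzExp_div_ne_zero hπ.1 z 0
    simp only [PowerSeries.coeff_mk]
    refine hsum _ (hz.trans_le (min_le_right _ _)) _ ?_
    have h1 : HasSum (fun n ↦ ∑ β : F, T⁻¹ * (PowerSeries.coeff n a *
        unif π (tpow F 0) (moebius (shiftGL (Polynomial.C β)) z : CInfty F) ^ n))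
        (∑ β : F, T⁻¹ * g (moebius (shiftGL (Polynomial.C β)) z)) :=
      hasSum_sum fun β _ ↦ (h _ (hδε z (hz.trans_le (min_le_left _ _)) β)).mul_left _
    rw [shiftSum_apply, Finset.sum_apply]
    simp only [slash_shiftGL]
    refine h1.congr_fun fun n ↦ ?_
    have hN := sum_inv_pow_eq_powerSumPoly (Nat.succ_ne_zero r) hE
      (carlitzExp_shift_injective hπ.1 (z : CInfty F)) hr (by rw [← hr]; exact natCast_card_eq_zero)
      (fun β ↦ by rw [← hr]; exact carlitzExp_shift hπ z β) n
    rw [unif_tpow_zero, ← hN, Finset.mul_sum]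
    refine Finset.sum_congr rfl fun β _ ↦ ?_
    rw [unif_tpow_zero, moebius_shiftGL, ← mul_assoc]
  · refine PowerSeries.nat_le_order _ _ fun i hi ↦ ?_
    rw [PowerSeries.coeff_mk]
    refine Finset.sum_eq_zero fun n _ ↦ ?_
    obtain rfl | rfl : i = 0 ∨ i = 1 := by omega
    · rw [powerSumPoly_coeff_zero, mul_zero]
    · by_cases hn : 2 ≤ n
      · rw [powerSumPoly_coeff_one _ _ hn, mul_zero]
      · have : PowerSeries.coeff n a = 0 :=
          PowerSeries.coeff_of_lt_order n (lt_of_lt_of_le (by norm_cast; omega) hja)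
        simp only [c, this, mul_zero, zero_mul]

end Drinfeld

namespace Drinfeld

open Polynomial (X C)

variable {F : Type*} [Field F] [Fintype F]

omit [Fintype F] in
theorem X_pow_dvd_of_dvd {a b : F[X]} {m n : ℕ} (h : (X : F[X]) ^ n ∣ a - b) (hmn : m ≤ n)
    (hb : X ^ m ∣ b) : X ^ m ∣ a := by
  have := dvd_add ((pow_dvd_pow _ hmn).trans h) hb
  rwa [sub_add_cancel] at this

/-! ### The effect of `U_t` on orders of vanishing -/

/-- `f` has at the cusp `ν(∞)` a Fourier expansion of order at least `j`. -/
def VanishesAt (π : CInfty F) (n : ℕ) (k : ℤ) (j : ℕ) (ν : SL(2, F[X]))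
    (f : Omega F → CInfty F) : Prop :=
  ∃ a, IsFourierExpansion π (X ^ n) k ν f a ∧ (j : ℕ∞) ≤ a.order

/-- `v` is the minimum of `n` and the `t`-adic valuation of the lower left entry of `ν`. -/
def IsCuspVal (n : ℕ) (ν : SL(2, F[X])) (v : ℕ) : Prop :=
  v ≤ n ∧ X ^ v ∣ ν 1 0 ∧ (v < n → ¬ X ^ (v + 1) ∣ ν 1 0)

omit [Fintype F] in
theorem exists_isCuspVal (n : ℕ) (ν : SL(2, F[X])) : ∃ v, IsCuspVal n ν v := by
  classical
  refine ⟨Nat.findGreatest (fun v ↦ X ^ v ∣ ν 1 0) n, Nat.findGreatest_le n, ?_, fun h ↦ ?_⟩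
  · exact Nat.findGreatest_spec (P := fun v ↦ X ^ v ∣ ν 1 0) (Nat.zero_le n) ⟨ν 1 0, by ring⟩
  · exact Nat.findGreatest_is_greatest (Nat.lt_succ_self _) h

omit [Fintype F] in
theorem IsCuspVal.le {n v m : ℕ} {ν : SL(2, F[X])} (h : IsCuspVal n ν v) (hm : m ≤ n)
    (hν : X ^ m ∣ ν 1 0) : m ≤ v := by
  by_contra! hlt
  exact h.2.2 (hlt.trans_le hm) ((pow_dvd_pow _ hlt).trans hν)

theorem IsCuspVal.vanishesAt_iff {π : CInfty F} {n v : ℕ} {k : ℤ} {j : ℕ} {ν : SL(2, F[X])}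
    (h : IsCuspVal n ν v) {f : Omega F → CInfty F} :
    VanishesAt π n k j ν f ↔ HasSeries π (n - v) j (slash k (slToGL ν) f) :=
  exists_fourierExpansion_iff (width_eq h.1 h.2.1 h.2.2)

omit [Fintype F] in
theorem not_X_dvd_of_X_dvd {ν : SL(2, F[X])} (h : X ∣ ν 1 0) : ¬ X ∣ ν 0 0 := fun h' ↦
  Polynomial.prime_X.not_dvd_one (sl2_det ν ▸ dvd_sub (h'.mul_right _) (h.mul_left _))

/-- Either the valuation rises to `v + 1` and the order at the new cusp is inherited, or `v = 0` and
mere vanishing is multiplied by `q`, which already exceeds the required `j ≤ 2`. -/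
theorem hasExpansion_slash_shiftGL_mul {π : CInfty F} (hπ : IsCarlitzPeriod π) {n v : ℕ} {k : ℤ}
    {j : ℕ} (hj : j ≤ 2) {f : Omega F → CInfty F} (hf : ∀ ν, VanishesAt π n k 1 ν f)
    {ν : SL(2, F[X])} (hν : IsCuspVal n ν v) (hv : v < n)
    (hfj : ∀ μ : SL(2, F[X]), X ^ (v + 1) ∣ μ 1 0 → VanishesAt π n k j μ f) (β : F) :
    HasExpansion π (n - v) j (slash k (shiftGL (C β) * slToGL ν) f) := by
  by_cases hX : X ∣ ν 0 0 + C β * ν 1 0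
  · obtain ⟨μ, hμ, h⟩ := exists_shiftGL_mul_eq_scaleGL ν (C β) hX
    have hz : ¬ X ∣ ν 1 0 := fun hd ↦
      not_X_dvd_of_X_dvd hd ((dvd_add_left (hd.mul_left _)).1 hX)
    obtain rfl : v = 0 := by
      by_contra h0
      exact hz ((dvd_pow_self _ h0).trans hν.2.1)
    have hμv : IsCuspVal n μ 0 := by unfold IsCuspVal; rw [hμ]; exact hν
    rw [h, slash_mul]
    have h1 := ((hμv.vanishesAt_iff.1 (hf μ)).hasExpansion hπ.1).slash_scaleGL hπ k
    refine h1.mono ?_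
    have : 1 < Fintype.card F := Fintype.one_lt_card
    omega
  · have hx0 : (ν 0 0 + C β * ν 1 0).coeff 0 ≠ 0 := by rwa [Ne, ← Polynomial.X_dvd_iff]
    -- The constant `b` is the quotient of the upper row of `(1 β; 0 t) ν` modulo `t`, whose first
    -- entry is nonzero there.
    obtain ⟨μ, -, hμ, -, h⟩ := exists_shiftGL_mul ν (C β)
      (C ((ν 0 1 + C β * ν 1 1).coeff 0 / (ν 0 0 + C β * ν 1 0).coeff 0)) (by
        rw [Polynomial.X_dvd_iff, Polynomial.coeff_sub, Polynomial.mul_coeff_zero _ (C _),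
          Polynomial.coeff_C_zero, mul_div_cancel₀ _ hx0, sub_self])
    have hμv : IsCuspVal n μ (v + 1) := by
      refine ⟨hv, ?_, fun _ hd ↦ hν.2.2 hv ?_⟩
      · rw [hμ, pow_succ']; exact mul_dvd_mul_left _ hν.2.1
      · rw [hμ, pow_succ'] at hd
        exact (mul_dvd_mul_iff_left Polynomial.X_ne_zero).1 hd
    rw [h, slash_mul, show n - v = n - (v + 1) + 1 by omega]
    exact ((hμv.vanishesAt_iff.1 (hfj μ hμv.2.1)).hasExpansion hπ.1).slash_shiftGL hπ.1 k _

/-- The cap `min (v + 1) n` merges the two regimes: for `v < n` the order comes from cusps of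
strictly larger valuation, while for `v = n` it comes from the cusp itself. -/
theorem vanishesAt_shiftSum {π : CInfty F} (hπ : IsCarlitzPeriod π) {n v : ℕ} (hn : n ≠ 0) {k : ℤ}
    {j : ℕ} (hj : j ≤ 2) {f : Omega F → CInfty F} (hinv : IsInvariant (X ^ n) k f)
    (hf : ∀ ν, VanishesAt π n k 1 ν f) {ν : SL(2, F[X])} (hν : IsCuspVal n ν v)
    (hfj : ∀ μ : SL(2, F[X]), X ^ min (v + 1) n ∣ μ 1 0 → VanishesAt π n k j μ f) :
    VanishesAt π n k j ν (shiftSum k f) := by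
  rw [hν.vanishesAt_iff]
  rcases hν.1.eq_or_lt with rfl | hv
  · rw [slash_shiftSum hn hinv hν.2.1, Nat.sub_self]
    have := hν.vanishesAt_iff.1 (hfj ν (by simpa using hν.2.1))
    rw [Nat.sub_self] at this
    exact this.shiftSum hπ hj k
  · rw [min_eq_left hv] at hfj
    rw [shiftSum_apply, map_sum]
    refine (HasExpansion.sum _ fun β _ ↦ ?_).hasSeries
    rw [← slash_mul]
    exact hasExpansion_slash_shiftGL_mul hπ hj hf hν hv hfj β

/-! ### Cusps -/

theorem natCast_le_cuspOrd_iff {π : CInfty F} {n : ℕ} {k : ℤ} {s : OnePoint (RatFunc F)}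
    {f : Omega F → CInfty F} {j : ℕ} (hj : j ≠ 0) :
    (j : ℕ∞) ≤ cuspOrd π (X ^ n) k s f ↔ ∀ ν, cusp ν = s → VanishesAt π n k j ν f :=
  natCast_le_cuspOrd hj

omit [Fintype F] in
-- The cusp is the ratio of the first column; cross-multiplying treats `∞` uniformly.
theorem cusp_eq_cusp_iff {μ ν : SL(2, F[X])} :
    cusp μ = cusp ν ↔ μ 0 0 * ν 1 0 = ν 0 0 * μ 1 0 := by
  let _ := Classical.decEq (RatFunc F)
  have hinj := IsFractionRing.injective F[X] (RatFunc F)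
  have h0 (ν : SL(2, F[X])) (h : ν 1 0 = 0) : ν 0 0 ≠ 0 := fun h' ↦ by
    simpa [h, h'] using sl2_det ν
  have hm (p : F[X]) : algebraMap F[X] (RatFunc F) p = 0 ↔ p = 0 := map_eq_zero_iff _ hinj
  have hinfty (ν : SL(2, F[X])) (h : ν 1 0 = 0) : cusp ν = OnePoint.infty := by
    rw [cusp, OnePoint.smul_infty_eq_ite]
    exact if_pos ((hm _).2 h)
  have hcoe (ν : SL(2, F[X])) (h : ν 1 0 ≠ 0) : cusp ν =
      ((algebraMap F[X] (RatFunc F) (ν 0 0) / algebraMap F[X] (RatFunc F) (ν 1 0) : RatFunc F) :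
        OnePoint (RatFunc F)) := by
    rw [cusp, OnePoint.smul_infty_eq_ite]
    exact if_neg ((hm _).not.2 h)
  by_cases h1 : μ 1 0 = 0 <;> by_cases h2 : ν 1 0 = 0
  · simp [hinfty, h1, h2]
  · simp [hinfty μ h1, hcoe ν h2, h1, h2, h0 μ h1]
  · simp [hcoe μ h1, hinfty ν h2, h1, h2, h0 ν h2]
  · rw [hcoe μ h1, hcoe ν h2, OnePoint.coe_eq_coe, div_eq_div_iff ((hm _).not.2 h1)
      ((hm _).not.2 h2), ← map_mul, ← map_mul, hinj.eq_iff]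

omit [Fintype F] in
theorem dvd_of_cusp_eq_cusp {μ ν : SL(2, F[X])} (h : cusp μ = cusp ν) {p : F[X]}
    (hp : p ∣ ν 1 0) : p ∣ μ 1 0 := by
  rw [cusp_eq_cusp_iff] at h
  refine hp.trans ⟨μ 0 0 * ν 1 1 - ν 0 1 * μ 1 0, ?_⟩
  linear_combination -(μ 1 0) * sl2_det ν - ν 1 1 * h

theorem mem_cuspForms_iff {π : CInfty F} {n : ℕ} {k : ℤ} {f : Omega F → CInfty F} :
    f ∈ cuspForms π (X ^ n) k ↔ IsRigidAnalytic f ∧ IsInvariant (X ^ n) k f ∧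
      ∀ ν, VanishesAt π n k 1 ν f := by
  change (_ ∧ _ ∧ _) ↔ _
  have h1 : (∀ s, 1 ≤ cuspOrd π (X ^ n) k s f) ↔ ∀ ν, VanishesAt π n k 1 ν f := by
    have := fun s ↦ natCast_le_cuspOrd_iff (π := π) (n := n) (k := k) (s := s) (f := f) one_ne_zero
    rw [Nat.cast_one] at this
    simp only [this]
    exact ⟨fun h ν ↦ h _ ν rfl, fun h s ν _ ↦ h ν⟩
  simp only [h1, IsInvariant, slash_eq_self_iff]

theorem mem_doubleCuspForms_iff {π : CInfty F} {n : ℕ} {k : ℤ} {f : Omega F → CInfty F} :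
    f ∈ doubleCuspForms π (X ^ n) k ↔ f ∈ cuspForms π (X ^ n) k ∧ ∀ ν, VanishesAt π n k 2 ν f := by
  change (_ ∧ _) ↔ _
  refine and_congr_right fun _ ↦ ?_
  have := fun s ↦ natCast_le_cuspOrd_iff (π := π) (n := n) (k := k) (s := s) (f := f) two_ne_zero
  rw [Nat.cast_two] at this
  simp only [this]
  exact ⟨fun h ν ↦ h _ ν rfl, fun h s ν _ ↦ h ν⟩

theorem shiftSum_mem_cuspForms {π : CInfty F} (hπ : IsCarlitzPeriod π) {n : ℕ} (hn : n ≠ 0) {k : ℤ}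
    {f : Omega F → CInfty F} (hf : f ∈ cuspForms π (X ^ n) k) :
    shiftSum k f ∈ cuspForms π (X ^ n) k := by
  rw [mem_cuspForms_iff] at hf ⊢
  refine ⟨hf.1.shiftSum k, hf.2.1.shiftSum hn, fun ν ↦ ?_⟩
  obtain ⟨v, hv⟩ := exists_isCuspVal n ν
  exact vanishesAt_shiftSum hπ hn one_le_two hf.2.1 hf.2.2 hv fun μ _ ↦ hf.2.2 μ

/-! ### The cusps `h_{(c,d)}(∞)` -/

omit [Fintype F] in
theorem out_sub_dvd {m : ℕ} (x : F[X]) :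
    (X : F[X]) ^ m ∣ (Ideal.Quotient.mk (Ideal.span {(X : F[X]) ^ m}) x : An F m).out - x := by
  rw [← Ideal.mem_span_singleton, ← Ideal.Quotient.mk_eq_mk_iff_sub_mem]
  exact Ideal.Quotient.mk_out _

omit [Fintype F] in
theorem natCast_le_vbar_iff {n e : ℕ} (he : e ≤ n - 1) {c : An F (n - 1)} :
    e ≤ vbar n c ↔ X ^ e ∣ c.out := by
  have htop : min (emultiplicity (X : F[X]) c.out) ((n - 1 : ℕ) : ℕ∞) ≠ ⊤ :=
    ((min_le_right _ _).trans_lt (ENat.natCast_lt_top _)).ne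
  rw [vbar, ← Nat.cast_le (α := ℕ∞), ENat.natCast_toNat htop, le_min_iff,
    pow_dvd_iff_le_emultiplicity]
  exact and_iff_left (Nat.cast_le.2 he)

omit [Fintype F] in
-- Scaling the first column by a constant makes its top entry `1` modulo `t` and does not move the
-- cusp; adding a multiple of it to the second column then makes the upper right entry divisible by
-- `t^n`.
theorem exists_isLift {n : ℕ} (hn : n ≠ 0) {ν : SL(2, F[X])} (hν : X ∣ ν 1 0) :
    ∃ (c d : An F (n - 1)) (h : SL(2, F[X])), IsLift n c d h ∧ cusp h = cusp ν ∧
      ∀ i ≤ n - 1, X ^ (i + 1) ∣ ν 1 0 → X ^ i ∣ c.out := by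
  have hx : ¬ X ∣ ν 0 0 := not_X_dvd_of_X_dvd hν
  set l := (ν 0 0).coeff 0 with hl
  have hl0 : l ≠ 0 := by rwa [Ne, ← Polynomial.X_dvd_iff]
  have hCl : C l⁻¹ * C l = 1 := by rw [← map_mul, inv_mul_cancel₀ hl0, map_one]
  have hcop : IsCoprime ((X : F[X]) ^ n) (C l⁻¹ * ν 0 0) := by
    refine IsCoprime.pow_left ((Polynomial.irreducible_X.coprime_iff_not_dvd).2 fun hd ↦ hx ?_)
    have := hd.mul_left (C l)
    rwa [← mul_assoc, mul_comm (C l), hCl, one_mul] at this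
  obtain ⟨a, b, hab⟩ := hcop
  -- `b` inverts the new upper left entry modulo `t^n`, so this multiple cancels the upper right
  -- entry modulo `t^n`.
  set s := -(C l * ν 0 1 * b)
  obtain ⟨h, h00, h01, h10, h11⟩ := exists_sl2 (a := C l⁻¹ * ν 0 0)
    (b := C l⁻¹ * ν 0 0 * s + C l * ν 0 1) (c := C l⁻¹ * ν 1 0)
    (d := C l⁻¹ * ν 1 0 * s + C l * ν 1 1)
    (by linear_combination C l⁻¹ * C l * sl2_det ν + hCl)
  have h01' : (X : F[X]) ^ n ∣ h 0 1 := by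
    rw [h01]
    exact ⟨C l * ν 0 1 * a, by linear_combination -(C l * ν 0 1) * hab⟩
  have h10' : X ∣ h 1 0 := h10 ▸ hν.mul_left _
  have h00' : X ∣ h 0 0 - 1 := by
    rw [Polynomial.X_dvd_iff, h00, Polynomial.coeff_sub, Polynomial.mul_coeff_zero,
      Polynomial.coeff_C_zero, ← hl, inv_mul_cancel₀ hl0, Polynomial.coeff_one_zero, sub_self]
  have h11' : X ∣ h 1 1 - 1 := by
    have h1 : h 1 1 - 1 = h 0 1 * h 1 0 - (h 0 0 - 1) * h 1 1 := by
      linear_combination sl2_det h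
    rw [h1]
    exact dvd_sub (h10'.mul_left _) (h00'.mul_right _)
  obtain ⟨z, hz⟩ := h10'
  obtain ⟨w, hw⟩ := h11'
  have hmk {x : F[X]} : (Ideal.Quotient.mk (Ideal.span {(X : F[X]) ^ n}) (X *
      (Ideal.Quotient.mk (Ideal.span {(X : F[X]) ^ (n - 1)}) x : An F (n - 1)).out) : An F n) =
      Ideal.Quotient.mk _ (X * x) := by
    rw [Ideal.Quotient.mk_eq_mk_iff_sub_mem, Ideal.mem_span_singleton, ← mul_sub]
    obtain ⟨m, rfl⟩ := Nat.exists_eq_succ_of_ne_zero hn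
    rw [Nat.succ_eq_add_one, pow_succ']
    exact mul_dvd_mul_left _ (out_sub_dvd x)
  have hinv : (Ideal.Quotient.mk (Ideal.span {(X : F[X]) ^ n}) (h 0 0) : An F n) *
      Ideal.Quotient.mk (Ideal.span {(X : F[X]) ^ n}) (h 1 1) = 1 := by
    rw [← map_mul, ← map_one (Ideal.Quotient.mk (Ideal.span {(X : F[X]) ^ n})),
      Ideal.Quotient.mk_eq_mk_iff_sub_mem, Ideal.mem_span_singleton]
    have h1 : h 0 0 * h 1 1 - 1 = h 0 1 * h 1 0 := by linear_combination sl2_det h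
    rw [h1]
    exact h01'.mul_right _
  have h11w : (1 + Ideal.Quotient.mk _ (X * w) : An F n) = Ideal.Quotient.mk _ (h 1 1) := by
    rw [← map_one (Ideal.Quotient.mk (Ideal.span {(X : F[X]) ^ n})), ← map_add, ← hw,
      add_sub_cancel]
  refine ⟨Ideal.Quotient.mk _ z, Ideal.Quotient.mk _ w, h,
    ⟨⟨h00', ⟨z, hz⟩, ⟨w, hw⟩⟩, ?_⟩, ?_, fun i hi hd ↦ ?_⟩
  · refine Matrix.ext fun i j ↦ ?_
    fin_cases i <;> fin_cases j
    · change Ideal.Quotient.mk _ (h 0 0) = Ring.inverse (1 + Ideal.Quotient.mk _ (X * _))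
      rw [hmk, h11w]
      exact (Ring.inverse_unit (Units.mk _ _ (by rw [mul_comm]; exact hinv) hinv)).symm
    · change Ideal.Quotient.mk _ (h 0 1) = 0
      rw [Ideal.Quotient.eq_zero_iff_mem, Ideal.mem_span_singleton]
      exact h01'
    · change Ideal.Quotient.mk _ (h 1 0) = Ideal.Quotient.mk _ (X * _)
      rw [hmk, hz]
    · change Ideal.Quotient.mk _ (h 1 1) = 1 + Ideal.Quotient.mk _ (X * _)
      rw [hmk, h11w]
  · rw [cusp_eq_cusp_iff, h00, h10]
    ring
  · refine X_pow_dvd_of_dvd (out_sub_dvd z) hi ?_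
    have h1 : X ^ (i + 1) ∣ X * z := hz ▸ h10 ▸ hd.mul_left _
    rw [pow_succ'] at h1
    exact (mul_dvd_mul_iff_left Polynomial.X_ne_zero).1 h1

omit [Fintype F] in
theorem IsLift.sub_dvd {n : ℕ} {c d : An F (n - 1)} {h : SL(2, F[X])} (hh : IsLift n c d h) :
    X ^ n ∣ h 1 0 - X * c.out := by
  have h1 : (Ideal.Quotient.mk (Ideal.span {(X : F[X]) ^ n}) (h 1 0) : An F n) =
    Ideal.Quotient.mk _ (X * c.out) := congr_fun₂ hh.2 1 0
  rwa [Ideal.Quotient.mk_eq_mk_iff_sub_mem, Ideal.mem_span_singleton] at h1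

/-! ### The filtration `S'_{k,i}` and the action of `U_t` on it. -/

theorem mem_SprimeI_iff {π : CInfty F} {n : ℕ} {k i : ℤ} {f : Omega F → CInfty F} :
    f ∈ SprimeI π n k i ↔ f ∈ cuspForms π (X ^ n) k ∧ ∀ c d, i ≤ vbar n c → ∀ h, IsLift n c d h →
      ∀ ν, cusp ν = cusp h → VanishesAt π n k 2 ν f := by
  change (_ ∧ _) ↔ _
  have := fun s ↦ natCast_le_cuspOrd_iff (π := π) (n := n) (k := k) (s := s) (f := f) two_ne_zero
  rw [Nat.cast_two] at this
  simp only [this, Prod.forall]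
  rfl

theorem mem_Sprime_iff {π : CInfty F} {n : ℕ} {k : ℤ} {f : Omega F → CInfty F} :
    f ∈ Sprime π n k ↔ f ∈ cuspForms π (X ^ n) k ∧ ∀ d h, IsLift n 0 d h →
      ∀ ν, cusp ν = cusp h → VanishesAt π n k 2 ν f := by
  change (_ ∧ _) ↔ _
  have := fun s ↦ natCast_le_cuspOrd_iff (π := π) (n := n) (k := k) (s := s) (f := f) two_ne_zero
  rw [Nat.cast_two] at this
  simp only [this]

omit [Fintype F] in
theorem sub_one_le_vbar_iff {n : ℕ} {c : An F (n - 1)} : n - 1 ≤ vbar n c ↔ c = 0 := by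
  rw [natCast_le_vbar_iff le_rfl, ← Ideal.mem_span_singleton, ← Ideal.Quotient.eq_zero_iff_mem]
  have h : (Ideal.Quotient.mk _ c.out : An F (n - 1)) = c := Ideal.Quotient.mk_out c
  rw [h]

theorem Sprime_eq_SprimeI (π : CInfty F) (n : ℕ) (k : ℤ) :
    Sprime π n k = SprimeI π n k (n - 1) := by
  ext f
  have h1 (c : An F (n - 1)) : (n : ℤ) - 1 ≤ vbar n c ↔ c = 0 := by
    rw [← sub_one_le_vbar_iff]; omega
  simp only [mem_Sprime_iff, mem_SprimeI_iff, h1]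
  exact and_congr_right fun _ ↦ ⟨fun h c d hc ↦ hc ▸ h d, fun h d ↦ h 0 d rfl⟩

theorem SprimeI_mono (π : CInfty F) (n : ℕ) (k : ℤ) : Monotone (SprimeI π n k) := by
  intro i j hij f hf
  rw [mem_SprimeI_iff] at hf ⊢
  exact ⟨hf.1, fun c d hc ↦ hf.2 c d (hij.trans hc)⟩

theorem doubleCuspForms_le_SprimeI (π : CInfty F) (n : ℕ) (k i : ℤ) :
    doubleCuspForms π (X ^ n) k ≤ SprimeI π n k i := fun f hf ↦ by
  rw [mem_doubleCuspForms_iff] at hf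
  rw [mem_SprimeI_iff]
  exact ⟨hf.1, fun _ _ _ _ _ ν _ ↦ hf.2 ν⟩

/-- Every such cusp is some `h_{(c,d)}(∞)`. The exponent is `i + 1` because the lower left entry of
`h_{(c,d)}` is `tc`, not `c`. -/
theorem vanishesAt_of_mem_SprimeI {π : CInfty F} {n i : ℕ} {k : ℤ} {f : Omega F → CInfty F}
    (hf : f ∈ SprimeI π n k i) (hi : i < n) {ν : SL(2, F[X])} (hν : X ^ (i + 1) ∣ ν 1 0) :
    VanishesAt π n k 2 ν f := by
  rw [mem_SprimeI_iff] at hf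
  obtain ⟨c, d, h, hh, hcusp, hc⟩ := exists_isLift (n := n) (by omega)
    ((dvd_pow_self X (Nat.succ_ne_zero i)).trans hν)
  have hi' : i ≤ n - 1 := by omega
  refine hf.2 c d ?_ h hh ν hcusp.symm
  exact_mod_cast (natCast_le_vbar_iff hi').2 (hc i hi' hν)

theorem mem_SprimeI_sub_one {π : CInfty F} {n i : ℕ} {k : ℤ} {f : Omega F → CInfty F} (hi : i < n)
    (hf : f ∈ cuspForms π (X ^ n) k)
    (h : ∀ ν : SL(2, F[X]), X ^ i ∣ ν 1 0 → VanishesAt π n k 2 ν f) :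
    f ∈ SprimeI π n k (i - 1) := by
  refine mem_SprimeI_iff.2 ⟨hf, fun c d hc μ hμ ν hν ↦ h ν (dvd_of_cusp_eq_cusp hν ?_)⟩
  refine X_pow_dvd_of_dvd hμ.sub_dvd hi.le ?_
  cases i with
  -- For `i = 0` the index `i - 1` is negative: all pairs `(c,d)` occur, and divisibility by `X ^ 0`
  -- is no condition.
  | zero => exact ⟨X * c.out, by ring⟩
  | succ i =>
    rw [pow_succ']
    refine mul_dvd_mul_left _ ((natCast_le_vbar_iff (by omega)).1 ?_)
    push_cast at hc
    omega

theorem vanishesAt_shiftSum_of_mem_SprimeI {π : CInfty F} (hπ : IsCarlitzPeriod π) {n i : ℕ} {k : ℤ}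
    {f : Omega F → CInfty F} (hf : f ∈ SprimeI π n k i) (hi : i < n) {ν : SL(2, F[X])}
    (hν : X ^ i ∣ ν 1 0) : VanishesAt π n k 2 ν (shiftSum k f) := by
  obtain ⟨-, hinv, h1⟩ := mem_cuspForms_iff.1 hf.1
  obtain ⟨v, hv⟩ := exists_isCuspVal n ν
  have hiv := hv.le hi.le hν
  refine vanishesAt_shiftSum hπ (by omega) le_rfl hinv h1 hv fun μ hμ ↦ ?_
  exact vanishesAt_of_mem_SprimeI hf hi ((pow_dvd_pow X (by omega)).trans hμ)

theorem Ut_eq_shiftSum {π : CInfty F} {n : ℕ} (hn : n ≠ 0) {k : ℤ} {f : Omega F → CInfty F}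
    (hf : f ∈ cuspForms π (X ^ n) k) : Ut n k f = shiftSum k f :=
  Ut_apply hn (mem_cuspForms_iff.1 hf).2.1

theorem Ut_mem_SprimeI {π : CInfty F} (hπ : IsCarlitzPeriod π) {n i : ℕ} (hi : i < n) {k : ℤ}
    {f : Omega F → CInfty F} (hf : f ∈ SprimeI π n k i) : Ut n k f ∈ SprimeI π n k (i - 1) := by
  have hn : n ≠ 0 := by omega
  rw [Ut_eq_shiftSum hn hf.1]
  exact mem_SprimeI_sub_one hi (shiftSum_mem_cuspForms hπ hn hf.1) fun ν ↦
    vanishesAt_shiftSum_of_mem_SprimeI hπ hf hi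

theorem Ut_mem_doubleCuspForms {π : CInfty F} (hπ : IsCarlitzPeriod π) {n : ℕ} (hn : n ≠ 0) {k : ℤ}
    {f : Omega F → CInfty F} (hf : f ∈ SprimeI π n k 0) :
    Ut n k f ∈ doubleCuspForms π (X ^ n) k := by
  rw [Ut_eq_shiftSum hn hf.1, mem_doubleCuspForms_iff]
  refine ⟨shiftSum_mem_cuspForms hπ hn hf.1, fun ν ↦ ?_⟩
  exact vanishesAt_shiftSum_of_mem_SprimeI hπ (i := 0) (by exact_mod_cast hf) (by omega)
    ⟨ν 1 0, by ring⟩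

theorem Ut_pow_mem_SprimeI {π : CInfty F} (hπ : IsCarlitzPeriod π) {n : ℕ} {k : ℤ}
    {f : Omega F → CInfty F} (hf : f ∈ SprimeI π n k (n - 1)) :
    ∀ m < n, (Ut n k ^ m) f ∈ SprimeI π n k ((n - 1 - m : ℕ) : ℤ) := by
  intro m hm
  induction m with
  | zero => rw [show ((n - 1 - 0 : ℕ) : ℤ) = n - 1 by omega]; exact hf
  | succ m ih =>
    rw [pow_succ', Module.End.mul_apply,
      show ((n - 1 - (m + 1) : ℕ) : ℤ) = ((n - 1 - m : ℕ) : ℤ) - 1 by omega]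
    exact Ut_mem_SprimeI hπ (by omega) (ih (by omega))

theorem Ut_pow_mem_doubleCuspForms {π : CInfty F} (hπ : IsCarlitzPeriod π) {n : ℕ} (hn : n ≠ 0)
    {k : ℤ} {f : Omega F → CInfty F} (hf : f ∈ SprimeI π n k (n - 1)) :
    (Ut n k ^ n) f ∈ doubleCuspForms π (X ^ n) k := by
  obtain ⟨m, rfl⟩ := Nat.exists_eq_succ_of_ne_zero hn
  have h := Ut_pow_mem_SprimeI hπ hf m (Nat.lt_succ_self m)
  rw [show m.succ - 1 - m = 0 by omega] at h
  have hpow : (Ut m.succ k ^ m.succ) f = Ut m.succ k ((Ut m.succ k ^ m) f) := by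
    rw [Nat.succ_eq_add_one, pow_succ', Module.End.mul_apply]
  exact hpow ▸ Ut_mem_doubleCuspForms hπ hn h

end Drinfeld

end

theorem proposition3p8 {F : Type*} [Field F] [Fintype F] (π : Drinfeld.CInfty F)
    (hπ : Drinfeld.IsCarlitzPeriod π) (n : ℕ) (hn : 1 ≤ n) (k : ℤ) (hk : 2 ≤ k) :
    (∀ i : ℤ, 0 ≤ i → i ≤ (n : ℤ) - 1 →
      (Drinfeld.SprimeI π n k i).map (Drinfeld.Ut n k) ≤ Drinfeld.SprimeI π n k (i - 1)) ∧
    (Drinfeld.SprimeI π n k 0).map (Drinfeld.Ut n k) ≤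
      Drinfeld.doubleCuspForms π (Polynomial.X ^ n) k ∧
    ∃ (h : ∀ f ∈ Drinfeld.Sprime π n k, Drinfeld.Ut n k f ∈ Drinfeld.Sprime π n k)
      (h' : Drinfeld.doubleInUnramified π n k ≤
        (Drinfeld.doubleInUnramified π n k).comap ((Drinfeld.Ut n k).restrict h)),
      IsNilpotent ((Drinfeld.doubleInUnramified π n k).mapQ (Drinfeld.doubleInUnramified π n k)
        ((Drinfeld.Ut n k).restrict h) h') := by
  have hn0 : n ≠ 0 := by omega
  have h1 : ∀ i : ℤ, 0 ≤ i → i ≤ (n : ℤ) - 1 → ∀ f ∈ Drinfeld.SprimeI π n k i,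
      Drinfeld.Ut n k f ∈ Drinfeld.SprimeI π n k (i - 1) := by
    intro i hi0 hi f hf
    lift i to ℕ using hi0
    exact Drinfeld.Ut_mem_SprimeI hπ (by omega) hf
  have hS := Drinfeld.Sprime_eq_SprimeI π n k
  have h : ∀ f ∈ Drinfeld.Sprime π n k, Drinfeld.Ut n k f ∈ Drinfeld.Sprime π n k := by
    rw [hS]
    -- `U_t` sends index `n - 1` to `n - 2`, and a smaller index means a smaller space.
    exact fun f hf ↦ Drinfeld.SprimeI_mono π n k (by omega) (h1 _ (by omega) le_rfl f hf)
  have h' : Drinfeld.doubleInUnramified π n k ≤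
      (Drinfeld.doubleInUnramified π n k).comap ((Drinfeld.Ut n k).restrict h) := fun _ hf ↦
    Drinfeld.Ut_mem_doubleCuspForms hπ hn0 (Drinfeld.doubleCuspForms_le_SprimeI π n k 0 hf)
  refine ⟨fun i hi0 hi ↦ Submodule.map_le_iff_le_comap.2 (h1 i hi0 hi),
    Submodule.map_le_iff_le_comap.2 fun f hf ↦ Drinfeld.Ut_mem_doubleCuspForms hπ hn0 hf,
    -- The exponent `n` comes from `n - 1` steps lowering the index from `n - 1` to `0`, and one
    -- more from `S'_{k,0}` into the double cuspforms.
    h, h', n, (Submodule.mapQ_pow _ h' n).symm.trans ?_⟩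
  refine Submodule.linearMap_qext _ (LinearMap.ext fun f ↦ ?_)
  rw [LinearMap.zero_comp, LinearMap.zero_apply, LinearMap.comp_apply, Submodule.mkQ_apply,
    Submodule.mapQ_apply, Submodule.Quotient.mk_eq_zero, Module.End.pow_restrict]
  exact Drinfeld.Ut_pow_mem_doubleCuspForms hπ hn0 (hS ▸ f.2)
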